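/- Let $N\ge 3$, $2^*=\frac{2N}{N-2}$ and $2<q<2^*$. Let $\mathcal H$ be the completion of the complex-valued functions $C_0^\infty(\mathbb R^N)$ under the norm $$\|v\|_{\mathcal H}^2=\int_{\mathbb R^N}|x|^{-(N-2)}|\nabla v|^2\,dx+\int_{\mathbb R^N}|x|^{-(N-2)}|v|^2\,dx ,$$ and let $\mathcal H_r$ be the subspace of $\mathcal H$ consisting of radial functions. Let $H$ be the completion of $\{\,|x|^{-\frac{N-2}{2}}v : v\in C_0^\infty(\mathbb R^N)\}$ under the norm $$\|u\|_{H}^2=\int_{\mathbb R^N}|x|^{-(N-2)}\bigl|\nabla\bigl(|x|^{\frac{N-2}{2}}u\bigr)\bigr|^2\,dx+\int_{\mathbb R^N}|u|^2\,dx ,$$ and let $H_r$ be the subspace of $H$ consisting of radial functions. Then the inclusions $$\mathcal H_r\hookrightarrow L^q\bigl(\mathbb R^N,|x|^{-\frac{N-2}{2}q}\,dx\bigr)\qquad\text{and}\qquad H_r\hookrightarrow L^q(\mathbb R^N)$$ are well defined, injective, bounded and compact. -/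

import Mathlib

open MeasureTheory Filter

noncomputable section

namespace HardyRadial

/-- The measure `|x|^s dx` on `ℝ^N`. -/
def powerMeasure (N : ℕ) (s : ℝ) : Measure (EuclideanSpace ℝ (Fin N)) :=
  (volume : Measure (EuclideanSpace ℝ (Fin N))).withDensity
    (fun x => ENNReal.ofReal (‖x‖ ^ s))

/-- The measure `dμ = |x|^{-(N-2)} dx` on `ℝ^N`. -/
abbrev hardyMeasure (N : ℕ) : Measure (EuclideanSpace ℝ (Fin N)) :=
  powerMeasure N (-((N : ℝ) - 2))

/-- The gradient `(∂₁ φ, …, ∂_N φ)` of a complex-valued function on `ℝ^N`, with values in `ℂ^N`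
with its Euclidean norm. -/
def cgrad {N : ℕ} (φ : EuclideanSpace ℝ (Fin N) → ℂ) (x : EuclideanSpace ℝ (Fin N)) :
    EuclideanSpace ℂ (Fin N) :=
  WithLp.toLp 2 (fun i => fderiv ℝ φ x (EuclideanSpace.single i (1 : ℝ)))

/-- The test functions `C_0^∞(ℝ^N)`, complex-valued. -/
def IsTest {N : ℕ} (φ : EuclideanSpace ℝ (Fin N) → ℂ) : Prop :=
  ContDiff ℝ (⊤ : ℕ∞) φ ∧ HasCompactSupport φ

/-- Multiplication by `|x|^{-(N-2)/2}`: the transformation `v ↦ u = |x|^{-(N-2)/2} v`. -/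
def hardyT {N : ℕ} (v : EuclideanSpace ℝ (Fin N) → ℂ) (x : EuclideanSpace ℝ (Fin N)) : ℂ :=
  ((‖x‖ ^ (-(((N : ℝ) - 2) / 2)) : ℝ) : ℂ) * v x

/-- Multiplication by `|x|^{(N-2)/2}`: the inverse transformation `u ↦ v = |x|^{(N-2)/2} u`. -/
def hardyTInv {N : ℕ} (u : EuclideanSpace ℝ (Fin N) → ℂ) (x : EuclideanSpace ℝ (Fin N)) : ℂ :=
  ((‖x‖ ^ (((N : ℝ) - 2) / 2) : ℝ) : ℂ) * u x

/-- The Hilbert space `L²(ℝ^N, m; ℂ) × L²(ℝ^N, |x|^{-(N-2)} dx; ℂ^N)` of pairs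
(function, gradient), with `‖(f, w)‖² = ∫ |f|² dm + ∫ |x|^{-(N-2)} |w|² dx`. -/
abbrev PairSpace (N : ℕ) (m : Measure (EuclideanSpace ℝ (Fin N))) : Type :=
  WithLp 2 (Lp ℂ 2 m × Lp (EuclideanSpace ℂ (Fin N)) 2 (hardyMeasure N))

theorem cgrad_add {N : ℕ} {φ ψ : EuclideanSpace ℝ (Fin N) → ℂ} (hφ : IsTest φ) (hψ : IsTest ψ) :
    cgrad (φ + ψ) = cgrad φ + cgrad ψ := by
  funext x
  ext i
  have h1 : DifferentiableAt ℝ φ x := hφ.1.differentiable (by simp) x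
  have h2 : DifferentiableAt ℝ ψ x := hψ.1.differentiable (by simp) x
  simp [cgrad, fderiv_add h1 h2]

theorem cgrad_smul {N : ℕ} {φ : EuclideanSpace ℝ (Fin N) → ℂ} (hφ : IsTest φ) (c : ℂ) :
    cgrad (c • φ) = c • cgrad φ := by
  funext x
  ext i
  have h1 : DifferentiableAt ℝ φ x := hφ.1.differentiable (by simp) x
  simp [cgrad, fderiv_const_smul h1 c]

theorem cgrad_zero {N : ℕ} : cgrad (0 : EuclideanSpace ℝ (Fin N) → ℂ) = 0 := by
  funext x
  ext i
  simp [cgrad]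

theorem IsTest.zero {N : ℕ} : IsTest (0 : EuclideanSpace ℝ (Fin N) → ℂ) :=
  ⟨contDiff_const, HasCompactSupport.zero⟩

theorem IsTest.add {N : ℕ} {φ ψ : EuclideanSpace ℝ (Fin N) → ℂ} (hφ : IsTest φ)
    (hψ : IsTest ψ) : IsTest (φ + ψ) :=
  ⟨hφ.1.add hψ.1, hφ.2.add hψ.2⟩

theorem IsTest.smul {N : ℕ} {φ : EuclideanSpace ℝ (Fin N) → ℂ} (hφ : IsTest φ) (c : ℂ) :
    IsTest (c • φ) :=
  ⟨contDiff_const.smul hφ.1, hφ.2.smul_left (f := fun _ => c)⟩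

theorem hardyTInv_hardyT {N : ℕ} (φ : EuclideanSpace ℝ (Fin N) → ℂ)
    {x : EuclideanSpace ℝ (Fin N)} (hx : x ≠ 0) : hardyTInv (hardyT φ) x = φ x := by
  have h : 0 < ‖x‖ := norm_pos_iff.mpr hx
  rw [hardyTInv, hardyT, ← mul_assoc, ← Complex.ofReal_mul, ← Real.rpow_add h]
  simp

theorem cgrad_hardyTInv_hardyT {N : ℕ} (φ : EuclideanSpace ℝ (Fin N) → ℂ)
    {x : EuclideanSpace ℝ (Fin N)} (hx : x ≠ 0) :
    cgrad (hardyTInv (hardyT φ)) x = cgrad φ x := by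
  have h : hardyTInv (hardyT φ) =ᶠ[nhds x] φ := by
    filter_upwards [isOpen_ne.mem_nhds hx] with y hy using hardyTInv_hardyT φ hy
  rw [cgrad, cgrad, h.fderiv_eq]

theorem ae_ne_zero {N : ℕ} (hN : 3 ≤ N) (s : ℝ) :
    ∀ᵐ x ∂(powerMeasure N s), x ≠ (0 : EuclideanSpace ℝ (Fin N)) := by
  have : Nonempty (Fin N) := ⟨⟨0, by omega⟩⟩
  have h : ∀ᵐ x : EuclideanSpace ℝ (Fin N), x ≠ 0 := by
    simp [ae_iff]
  exact (withDensity_absolutelyContinuous _ _).ae_le h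

/-- The subspace `C_0^∞(ℝ^N)`, each `φ` being recorded as the pair `(φ, ∇φ)`, so that
`‖(φ, ∇φ)‖² = ∫ |x|^{-(N-2)} |∇φ|² dx + ∫ |x|^{-(N-2)} |φ|² dx`. -/
def testPairs (N : ℕ) : Submodule ℂ (PairSpace N (hardyMeasure N)) where
  carrier := {p | ∃ φ : EuclideanSpace ℝ (Fin N) → ℂ, IsTest φ ∧
    p.fst =ᵐ[hardyMeasure N] φ ∧ p.snd =ᵐ[hardyMeasure N] cgrad φ}
  zero_mem' := ⟨0, IsTest.zero, Lp.coeFn_zero _ _ _, by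
    rw [cgrad_zero]; exact Lp.coeFn_zero _ _ _⟩
  add_mem' := by
    rintro p p' ⟨φ, hφ, h1, h2⟩ ⟨ψ, hψ, h3, h4⟩
    refine ⟨φ + ψ, hφ.add hψ, (Lp.coeFn_add _ _).trans (h1.add h3), ?_⟩
    rw [cgrad_add hφ hψ]
    exact (Lp.coeFn_add _ _).trans (h2.add h4)
  smul_mem' := by
    rintro c p ⟨φ, hφ, h1, h2⟩
    refine ⟨c • φ, hφ.smul c, (Lp.coeFn_smul _ _).trans (h1.const_smul c), ?_⟩
    rw [cgrad_smul hφ c]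
    exact (Lp.coeFn_smul _ _).trans (h2.const_smul c)

/-- The space `𝓗`: the completion of `C_0^∞(ℝ^N)` in the norm
`‖v‖² = ∫ |x|^{-(N-2)} (|∇v|² + |v|²) dx`, realised as a closure in the ambient Hilbert space. The
function `v` is the first component of a pair; the second component is its gradient. -/
def spaceCalH (N : ℕ) : Submodule ℂ (PairSpace N (hardyMeasure N)) :=
  (testPairs N).topologicalClosure

/-- The subspace `{u = |x|^{-(N-2)/2} φ : φ ∈ C_0^∞(ℝ^N)}`, each `u` being recorded as the pair
`(u, ∇(|x|^{(N-2)/2} u))`, so that its squared norm is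
`∫ |x|^{-(N-2)} |∇(|x|^{(N-2)/2} u)|² dx + ∫ |u|² dx`. -/
def transformedPairs (N : ℕ) (hN : 3 ≤ N) : Submodule ℂ (PairSpace N volume) where
  carrier := {p | ∃ φ : EuclideanSpace ℝ (Fin N) → ℂ, IsTest φ ∧
    p.fst =ᵐ[volume] hardyT φ ∧ p.snd =ᵐ[hardyMeasure N] cgrad (hardyTInv (hardyT φ))}
  zero_mem' := by
    refine ⟨0, IsTest.zero, ?_, ?_⟩
    · refine (Lp.coeFn_zero _ _ _).trans (Eventually.of_forall fun x => ?_)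
      simp [hardyT]
    · refine (Lp.coeFn_zero _ _ _).trans ?_
      filter_upwards [ae_ne_zero hN _] with x hx
      rw [cgrad_hardyTInv_hardyT _ hx, cgrad_zero]
  add_mem' := by
    rintro p p' ⟨φ, hφ, h1, h2⟩ ⟨ψ, hψ, h3, h4⟩
    refine ⟨φ + ψ, hφ.add hψ, ?_, ?_⟩
    · refine (Lp.coeFn_add _ _).trans ((h1.add h3).trans (Eventually.of_forall fun x => ?_))
      simp [hardyT, mul_add]
    · refine (Lp.coeFn_add _ _).trans ((h2.add h4).trans ?_)
      filter_upwards [ae_ne_zero hN _] with x hx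
      simp only [cgrad_hardyTInv_hardyT _ hx, cgrad_add hφ hψ, Pi.add_apply]
  smul_mem' := by
    rintro c p ⟨φ, hφ, h1, h2⟩
    refine ⟨c • φ, hφ.smul c, ?_, ?_⟩
    · refine (Lp.coeFn_smul _ _).trans
        ((h1.const_smul c).trans (Eventually.of_forall fun x => ?_))
      simp [hardyT, mul_left_comm]
    · refine (Lp.coeFn_smul _ _).trans ((h2.const_smul c).trans ?_)
      filter_upwards [ae_ne_zero hN _] with x hx
      simp only [cgrad_hardyTInv_hardyT _ hx, cgrad_smul hφ c, Pi.smul_apply]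

/-- The space `H`: the completion of `{|x|^{-(N-2)/2} φ : φ ∈ C_0^∞(ℝ^N)}` in the norm
`N(u)² = ∫ |x|^{-(N-2)} |∇(|x|^{(N-2)/2} u)|² dx + ∫ |u|² dx`. The function `u` is the first
component of a pair. -/
def spaceH (N : ℕ) (hN : 3 ≤ N) : Submodule ℂ (PairSpace N volume) :=
  (transformedPairs N hN).topologicalClosure

/-- `f` is radial: `f(x)` is almost everywhere a function of `|x|` alone. -/
def IsRadial {N : ℕ} (m : Measure (EuclideanSpace ℝ (Fin N)))
    (f : EuclideanSpace ℝ (Fin N) → ℂ) : Prop :=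
  ∃ g : ℝ → ℂ, ∀ᵐ x ∂m, f x = g ‖x‖

/-- The subspace of a space `V` of (function, gradient) pairs whose function is radial. -/
def radialPart {N : ℕ} {m : Measure (EuclideanSpace ℝ (Fin N))}
    (V : Submodule ℂ (PairSpace N m)) : Submodule ℂ (PairSpace N m) where
  carrier := {p | p ∈ V ∧ IsRadial m p.fst}
  zero_mem' := ⟨V.zero_mem, 0, Lp.coeFn_zero _ _ _⟩
  add_mem' := by
    rintro p p' ⟨hp, g, hg⟩ ⟨hp', g', hg'⟩
    refine ⟨V.add_mem hp hp', g + g', ?_⟩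
    filter_upwards [Lp.coeFn_add p.fst p'.fst, hg, hg'] with x h1 h2 h3
    rw [Pi.add_apply, ← h2, ← h3]
    exact h1
  smul_mem' := by
    rintro c p ⟨hp, g, hg⟩
    refine ⟨V.smul_mem c hp, c • g, ?_⟩
    filter_upwards [Lp.coeFn_smul c p.fst, hg] with x h1 h2
    rw [Pi.smul_apply, ← h2]
    exact h1

/-- `V` embeds compactly into `L^q(ℝ^N, ν)`: the inclusion (sending an element of `V` to the
function that it represents) is a well-defined injective bounded linear map into `L^q(ℝ^N, ν)`,
and it is a compact operator. -/
def EmbedsCompactly {N : ℕ} {m : Measure (EuclideanSpace ℝ (Fin N))}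
    (V : Submodule ℂ (PairSpace N m)) (q : ℝ) [Fact (1 ≤ ENNReal.ofReal q)]
    (ν : Measure (EuclideanSpace ℝ (Fin N))) : Prop :=
  ∃ J : V →L[ℂ] Lp ℂ (ENNReal.ofReal q) ν,
    (∀ p : V, J p =ᵐ[volume] (p : PairSpace N m).fst) ∧
      Function.Injective J ∧ IsCompactOperator J

end HardyRadial

end

noncomputable section

namespace HardyRadial

open Topology

/-! ### Polar coordinates and null sets -/

section Polar

variable {E : Type*} [NormedAddCommGroup E] [NormedSpace ℝ E] [MeasurableSpace E] [BorelSpace E]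
  [FiniteDimensional ℝ E] [Nontrivial E] (μ : Measure E) [μ.IsAddHaarMeasure]

/-! In polar coordinates `|x|^{-(N-2)} dx` becomes `ρ dρ dθ`, as in the plane. Along a ray, the
fundamental theorem of calculus and Cauchy–Schwarz with `1 = ρ^{-1/2} ρ^{1/2}` bound the squared
increment of a test function by `log (r/s)` times the weighted energy of that ray
(`enorm_sub_sq_le_of_ray`). The approximating test functions need not be radial, so this is
integrated over the sphere and passed to a radial limit by Fatou. The limit profile satisfies `|g r
- g s|² ≤ K |log r - log s| b²` on a conull set of radii, where `b` is the norm, and the `L²` bound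
on one annulus upgrades this to `|g r|² ≤ K (1 + |log r|) b²` (`exists_hasLogProfile`).

Logarithmic growth is harmless at both ends. Near the origin, `q < 2*` makes `|x|^{-(N-2)q/2}`
integrable with room to spare; at infinity, `q > 2` leaves a decaying power in front of
`|x|^{-(N-2)} |v|²`. The tails are therefore uniformly small (`exists_lintegral_compl_annulus_le`).
On the remaining annulus the profiles are equicontinuous in `log r`, hence uniformly close to step
functions with boundedly many cells and bounded values (`exists_step_approx`). This gives
boundedness, and total boundedness of the image of the unit ball.

Injectivity needs an argument because elements are pairs (function, gradient): the gradient must be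
determined by the function, which is the closability of the weighted gradient
(`gradient_limit_eq_zero`).

Both inclusions are treated at once through `v = |x|^β f`, with `β = 0` for `𝓗` and `β = (N-2)/2`
for `H`. -/

theorem lintegral_polar {f : E → ENNReal} (hf : Measurable f) :
    ∫⁻ x, f x ∂μ = ∫⁻ θ : Metric.sphere (0 : E) 1, (∫⁻ r in Set.Ioi (0 : ℝ),
      ENNReal.ofReal (r ^ (Module.finrank ℝ E - 1)) * f (r • (θ : E))) ∂μ.toSphere := by
  have hmp := μ.measurePreserving_homeomorphUnitSphereProd
  have h0 : ∫⁻ x, f x ∂μ = ∫⁻ x : ({(0)}ᶜ : Set E), f x ∂(μ.comap (↑)) := by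
    rw [lintegral_subtype_comap (measurableSet_singleton _).compl f, restrict_compl_singleton]
  have hg : Measurable fun z : Metric.sphere (0 : E) 1 × Set.Ioi (0 : ℝ) =>
      f ((z.2 : ℝ) • (z.1 : E)) := hf.comp (by fun_prop)
  have h1 : ∫⁻ x : ({(0)}ᶜ : Set E), f x ∂(μ.comap (↑)) =
      ∫⁻ z, f ((z.2 : ℝ) • (z.1 : E))
        ∂(μ.toSphere.prod (Measure.volumeIoiPow (Module.finrank ℝ E - 1))) := by
    rw [← hmp.lintegral_comp hg]
    refine lintegral_congr fun x => ?_
    have hx : ‖(x : E)‖ ≠ 0 := norm_ne_zero_iff.2 x.2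
    simp [smul_smul, hx]
  rw [h0, h1, lintegral_prod _ hg.aemeasurable]
  refine lintegral_congr fun θ => ?_
  have hgθ : Measurable fun r : Set.Ioi (0 : ℝ) => f ((r : ℝ) • (θ : E)) :=
    hf.comp (by fun_prop)
  rw [Measure.volumeIoiPow, lintegral_withDensity_eq_lintegral_mul _ (by fun_prop) hgθ]
  exact lintegral_subtype_comap measurableSet_Ioi
    (fun r : ℝ => ENNReal.ofReal (r ^ (Module.finrank ℝ E - 1)) * f (r • (θ : E)))

/-- The density `r^n` is positive on `(0, ∞)`, so it does not change the null sets. -/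
theorem ae_volumeIoiPow_iff (n : ℕ) {Q : ℝ → Prop} :
    (∀ᵐ r : Set.Ioi (0 : ℝ) ∂(Measure.volumeIoiPow n), Q r) ↔ ∀ᵐ r ∂volume.restrict (Set.Ioi (0 : ℝ)), Q r := by
  rw [Measure.volumeIoiPow, ae_withDensity_iff (by fun_prop),
    ← map_comap_subtype_coe measurableSet_Ioi volume,
    (MeasurableEmbedding.subtype_coe measurableSet_Ioi).ae_map_iff]
  refine eventually_congr (Eventually.of_forall fun r => ?_)
  have : ENNReal.ofReal ((r : ℝ) ^ n) ≠ 0 := by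
    simpa using pow_pos r.2 n
  simp [this]

/-- Fubini, with the factors swapped so that the radius is the outer variable: almost every sphere
is good in almost every direction. -/
theorem ae_polar {P : E → Prop} (hP : ∀ᵐ x ∂μ, P x) :
    ∀ᵐ r ∂volume.restrict (Set.Ioi (0 : ℝ)), ∀ᵐ θ : Metric.sphere (0 : E) 1 ∂μ.toSphere, P (r • (θ : E)) := by
  have hmp := μ.measurePreserving_homeomorphUnitSphereProd
  have h1 : ∀ᵐ x : ({(0)}ᶜ : Set E) ∂(μ.comap (↑)), P x := by
    have := hP
    rw [← restrict_compl_singleton (μ := μ) 0,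
      ← map_comap_subtype_coe (measurableSet_singleton (0 : E)).compl μ,
      (MeasurableEmbedding.subtype_coe (measurableSet_singleton (0 : E)).compl).ae_map_iff] at this
    exact this
  have h2 : ∀ᵐ z ∂(μ.toSphere.prod (Measure.volumeIoiPow (Module.finrank ℝ E - 1))),
      P ((z.2 : ℝ) • (z.1 : E)) := by
    rw [← hmp.map_eq, (homeomorphUnitSphereProd E).measurableEmbedding.ae_map_iff]
    filter_upwards [h1] with x hx
    have hx' : ‖(x : E)‖ ≠ 0 := norm_ne_zero_iff.2 x.2
    simpa [smul_smul, hx'] using hx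
  have h3 := Measure.ae_ae_of_ae_prod (Measure.measurePreserving_swap.quasiMeasurePreserving.ae h2)
  exact (ae_volumeIoiPow_iff _ (Q := fun r : ℝ => ∀ᵐ θ : Metric.sphere (0 : E) 1 ∂μ.toSphere, P (r • (θ : E)))).1 h3

theorem ae_comp_norm {Q : ℝ → Prop} (hQ : ∀ᵐ r ∂volume.restrict (Set.Ioi (0 : ℝ)), Q r) :
    ∀ᵐ x ∂μ, Q ‖x‖ := by
  have hmp := μ.measurePreserving_homeomorphUnitSphereProd
  have h1 := (ae_volumeIoiPow_iff (Module.finrank ℝ E - 1)).2 hQ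
  have h2 : ∀ᵐ z ∂(μ.toSphere.prod (Measure.volumeIoiPow (Module.finrank ℝ E - 1))),
      Q (z.2 : ℝ) := Measure.quasiMeasurePreserving_snd.ae h1
  have h3 := hmp.quasiMeasurePreserving.ae h2
  rw [← restrict_compl_singleton (μ := μ) 0,
      ← map_comap_subtype_coe (measurableSet_singleton (0 : E)).compl μ,
      (MeasurableEmbedding.subtype_coe (measurableSet_singleton (0 : E)).compl).ae_map_iff]
  simpa using h3

end Polar

/-! ### Oscillation of test functions between spheres -/

theorem measurable_norm_rpow {N : ℕ} (s : ℝ) :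
    Measurable fun x : EuclideanSpace ℝ (Fin N) => ENNReal.ofReal (‖x‖ ^ s) := by
  fun_prop

theorem lintegral_powerMeasure {N : ℕ} (s : ℝ) {f : EuclideanSpace ℝ (Fin N) → ENNReal}
    (hf : AEMeasurable f) :
    ∫⁻ x, f x ∂(powerMeasure N s) = ∫⁻ x, ENNReal.ofReal (‖x‖ ^ s) * f x := by
  rw [powerMeasure, lintegral_withDensity_eq_lintegral_mul₀ (by fun_prop) hf]
  rfl

theorem norm_fderiv_le_norm_cgrad {N : ℕ} (φ : EuclideanSpace ℝ (Fin N) → ℂ)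
    (x v : EuclideanSpace ℝ (Fin N)) : ‖fderiv ℝ φ x v‖ ≤ ‖cgrad φ x‖ * ‖v‖ := by
  have hv : v = ∑ i, v i • EuclideanSpace.single i (1 : ℝ) := by
    have := (EuclideanSpace.basisFun (Fin N) ℝ).sum_repr v
    simpa using this.symm
  have h1 : fderiv ℝ φ x v = ∑ i, v i • fderiv ℝ φ x (EuclideanSpace.single i (1 : ℝ)) := by
    conv_lhs => rw [hv]
    simp
  rw [h1, EuclideanSpace.norm_eq, EuclideanSpace.norm_eq, mul_comm]
  refine (norm_sum_le _ _).trans ?_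
  simp only [norm_smul, cgrad]
  exact Real.sum_mul_le_sqrt_mul_sqrt _ _ _

theorem continuous_cgrad {N : ℕ} {φ : EuclideanSpace ℝ (Fin N) → ℂ} (hφ : IsTest φ) :
    Continuous (cgrad φ) := by
  have : Continuous (fderiv ℝ φ) := hφ.1.continuous_fderiv (by simp)
  unfold cgrad
  fun_prop

theorem sq_lintegral_mul_le {α : Type*} [MeasurableSpace α] (μ : Measure α) {f g : α → ENNReal}
    (hf : AEMeasurable f μ) (hg : AEMeasurable g μ) :
    (∫⁻ a, f a * g a ∂μ) ^ 2 ≤ (∫⁻ a, f a ^ 2 ∂μ) * ∫⁻ a, g a ^ 2 ∂μ := by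
  have h := ENNReal.lintegral_mul_le_Lp_mul_Lq μ Real.HolderConjugate.two_two hf hg
  have h2 := pow_le_pow_left' h 2
  simp only [Pi.mul_apply, mul_pow, ← ENNReal.rpow_natCast, ← ENNReal.rpow_mul] at h2 ⊢
  simpa using h2

theorem lintegral_inv_Ioc {s r : ℝ} (hs : 0 < s) (hsr : s ≤ r) :
    ∫⁻ ρ in Set.Ioc s r, ENNReal.ofReal ρ⁻¹ = ENNReal.ofReal (Real.log (r / s)) := by
  rw [← integral_inv_of_pos hs (hs.trans_le hsr), intervalIntegral.integral_of_le hsr,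
    ofReal_integral_eq_lintegral_ofReal]
  · have := intervalIntegral.intervalIntegrable_inv (μ := volume) (f := id) (a := s) (b := r)
      (fun x hx => by
        rw [Set.uIcc_of_le hsr] at hx
        exact (hs.trans_le hx.1).ne') continuousOn_id
    exact (intervalIntegrable_iff_integrableOn_Ioc_of_le hsr).1 this
  · filter_upwards [ae_restrict_mem measurableSet_Ioc] with ρ hρ
    exact inv_nonneg.2 (hs.trans hρ.1).le

/-- Cauchy–Schwarz with `1 = ρ^{-1/2} ρ^{1/2}`: the first factor squared integrates to the
logarithm, the second carries the weight `ρ` that polar coordinates leave of `|x|^{-(N-2)} dx`. -/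
theorem enorm_sub_sq_le_of_ray {N : ℕ} {φ : EuclideanSpace ℝ (Fin N) → ℂ} (hφ : IsTest φ)
    {θ : EuclideanSpace ℝ (Fin N)} (hθ : ‖θ‖ = 1) {s r : ℝ} (hs : 0 < s) (hsr : s ≤ r) :
    ‖φ (r • θ) - φ (s • θ)‖ₑ ^ 2 ≤ ENNReal.ofReal (Real.log (r / s)) *
      ∫⁻ ρ in Set.Ioi (0 : ℝ), ENNReal.ofReal ρ * ‖cgrad φ (ρ • θ)‖ₑ ^ 2 := by
  have hd : ∀ ρ : ℝ, HasDerivAt (fun ρ : ℝ => φ (ρ • θ)) (fderiv ℝ φ (ρ • θ) θ) ρ := by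
    intro ρ
    have h1 : DifferentiableAt ℝ φ (ρ • θ) := hφ.1.differentiable (by simp) _
    have h2 : HasDerivAt (fun ρ : ℝ => ρ • θ) θ ρ := by
      simpa using (hasDerivAt_id ρ).smul_const θ
    exact h1.hasFDerivAt.comp_hasDerivAt ρ h2
  have hc : Continuous fun ρ : ℝ => fderiv ℝ φ (ρ • θ) θ := by
    have : Continuous (fderiv ℝ φ) := hφ.1.continuous_fderiv (by simp)
    fun_prop
  have hcg : Continuous fun ρ : ℝ => cgrad φ (ρ • θ) :=
    (continuous_cgrad hφ).comp (by fun_prop)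
  have hftc := intervalIntegral.integral_eq_sub_of_hasDerivAt (a := s) (b := r)
    (fun ρ _ => hd ρ) (hc.intervalIntegrable _ _)
  have h3 : ‖φ (r • θ) - φ (s • θ)‖ₑ ≤ ∫⁻ ρ in Set.Ioc s r, ‖cgrad φ (ρ • θ)‖ₑ := by
    rw [← hftc, intervalIntegral.integral_of_le hsr]
    refine (enorm_integral_le_lintegral_enorm _).trans (lintegral_mono fun ρ => ?_)
    rw [enorm_le_iff_norm_le]
    simpa [hθ] using norm_fderiv_le_norm_cgrad φ (ρ • θ) θ
  have h4 : ∫⁻ ρ in Set.Ioc s r, ‖cgrad φ (ρ • θ)‖ₑ =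
      ∫⁻ ρ in Set.Ioc s r, ENNReal.ofReal √ρ⁻¹ * (ENNReal.ofReal √ρ * ‖cgrad φ (ρ • θ)‖ₑ) := by
    refine setLIntegral_congr_fun measurableSet_Ioc fun ρ hρ => ?_
    have hρ0 : 0 < ρ := hs.trans hρ.1
    rw [← mul_assoc, ← ENNReal.ofReal_mul (by positivity), ← Real.sqrt_mul (by positivity),
      inv_mul_cancel₀ hρ0.ne']
    simp
  rw [h4] at h3
  have hm1 : Measurable fun ρ : ℝ => ENNReal.ofReal √ρ⁻¹ :=
    (Real.continuous_sqrt.measurable.comp measurable_inv).ennreal_ofReal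
  have hm2 : Measurable fun ρ : ℝ => ENNReal.ofReal √ρ * ‖cgrad φ (ρ • θ)‖ₑ :=
    Real.continuous_sqrt.measurable.ennreal_ofReal.mul hcg.enorm.measurable
  have h7 := sq_lintegral_mul_le (volume.restrict (Set.Ioc s r))
    (f := fun ρ => ENNReal.ofReal √ρ⁻¹) (g := fun ρ => ENNReal.ofReal √ρ * ‖cgrad φ (ρ • θ)‖ₑ)
    hm1.aemeasurable hm2.aemeasurable
  have h8 : ‖φ (r • θ) - φ (s • θ)‖ₑ ^ 2 ≤ _ := (pow_le_pow_left' h3 2).trans h7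
  refine h8.trans ?_
  have h5 : ∫⁻ ρ in Set.Ioc s r, ENNReal.ofReal √ρ⁻¹ ^ 2 =
      ENNReal.ofReal (Real.log (r / s)) := by
    rw [← lintegral_inv_Ioc hs hsr]
    refine setLIntegral_congr_fun measurableSet_Ioc fun ρ hρ => ?_
    have hρ0 : 0 < ρ := hs.trans hρ.1
    rw [← ENNReal.ofReal_pow (by positivity), Real.sq_sqrt (by positivity)]
  have h6 : ∫⁻ ρ in Set.Ioc s r, (ENNReal.ofReal √ρ * ‖cgrad φ (ρ • θ)‖ₑ) ^ 2 =
      ∫⁻ ρ in Set.Ioc s r, ENNReal.ofReal ρ * ‖cgrad φ (ρ • θ)‖ₑ ^ 2 := by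
    refine setLIntegral_congr_fun measurableSet_Ioc fun ρ hρ => ?_
    have hρ0 : 0 < ρ := hs.trans hρ.1
    rw [mul_pow, ← ENNReal.ofReal_pow (by positivity), Real.sq_sqrt (by positivity)]
  rw [h5, h6]
  gcongr
  exact fun ρ hρ => hs.trans hρ.1

/-- The surface measure on the unit sphere of `ℝ^N`. -/
abbrev sphereMeasure (N : ℕ) : Measure (Metric.sphere (0 : EuclideanSpace ℝ (Fin N)) 1) :=
  (volume : Measure (EuclideanSpace ℝ (Fin N))).toSphere

/-- The Jacobian `ρ^{N-1}` meets the weight `ρ^{-(N-2)}`, and the product is `ρ` in every dimension.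
-/
theorem lintegral_hardyMeasure_eq {N : ℕ} (hN : 3 ≤ N) {f : EuclideanSpace ℝ (Fin N) → ENNReal}
    (hf : Measurable f) :
    ∫⁻ x, f x ∂(hardyMeasure N) = ∫⁻ θ : Metric.sphere (0 : EuclideanSpace ℝ (Fin N)) 1,
      (∫⁻ ρ in Set.Ioi (0 : ℝ), ENNReal.ofReal ρ * f (ρ • (θ : EuclideanSpace ℝ (Fin N))))
        ∂(sphereMeasure N) := by
  have : Nonempty (Fin N) := ⟨⟨0, by omega⟩⟩
  rw [lintegral_powerMeasure _ hf.aemeasurable, lintegral_polar _ (by fun_prop)]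
  refine lintegral_congr fun θ => setLIntegral_congr_fun measurableSet_Ioi fun ρ hρ => ?_
  have hρ0 : (0 : ℝ) < ρ := hρ
  have hθ : ‖(θ : EuclideanSpace ℝ (Fin N))‖ = 1 := by simp
  rw [← mul_assoc, ← ENNReal.ofReal_mul (by positivity), norm_smul, hθ, mul_one,
    Real.norm_of_nonneg hρ0.le, ← Real.rpow_natCast, ← Real.rpow_add hρ0]
  congr 2
  rw [finrank_euclideanSpace_fin, Nat.cast_sub (by omega)]
  norm_num

theorem lintegral_sphere_sub_sq_le {N : ℕ} (hN : 3 ≤ N) {φ : EuclideanSpace ℝ (Fin N) → ℂ}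
    (hφ : IsTest φ) {s r : ℝ} (hs : 0 < s) (hsr : s ≤ r) :
    ∫⁻ θ : Metric.sphere (0 : EuclideanSpace ℝ (Fin N)) 1,
      ‖φ (r • (θ : EuclideanSpace ℝ (Fin N))) - φ (s • (θ : EuclideanSpace ℝ (Fin N)))‖ₑ ^ 2
        ∂(sphereMeasure N) ≤
      ENNReal.ofReal (Real.log (r / s)) * ∫⁻ x, ‖cgrad φ x‖ₑ ^ 2 ∂(hardyMeasure N) := by
  have hc := continuous_cgrad hφ
  rw [lintegral_hardyMeasure_eq hN (by fun_prop), ← lintegral_const_mul' _ _ ENNReal.ofReal_ne_top]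
  exact lintegral_mono fun θ => enorm_sub_sq_le_of_ray hφ (by simp) hs hsr

/-! ### Logarithmic control of radial limits -/

theorem volume_absolutelyContinuous_powerMeasure {N : ℕ} (hN : 3 ≤ N) (s : ℝ) :
    (volume : Measure (EuclideanSpace ℝ (Fin N))) ≪ powerMeasure N s := by
  refine withDensity_absolutelyContinuous' (by fun_prop) ?_
  have : Nonempty (Fin N) := ⟨⟨0, by omega⟩⟩
  have h : ∀ᵐ x : EuclideanSpace ℝ (Fin N), x ≠ 0 := by
    simp [ae_iff]
  filter_upwards [h] with x hx
  have : 0 < ‖x‖ ^ s := Real.rpow_pos_of_pos (norm_pos_iff.2 hx) _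
  simpa using this

theorem powerMeasure_absolutelyContinuous_volume {N : ℕ} (s : ℝ) :
    powerMeasure N s ≪ (volume : Measure (EuclideanSpace ℝ (Fin N))) :=
  withDensity_absolutelyContinuous _ _

/-- If test functions converge almost everywhere to a radial function, then the radial profile has
logarithmic modulus of continuity on a conull set of radii. -/
theorem exists_conull_sphere_mul_sub_sq_le {N : ℕ} (hN : 3 ≤ N)
    {φ : ℕ → EuclideanSpace ℝ (Fin N) → ℂ} (hφ : ∀ n, IsTest (φ n)) {g : ℝ → ℂ}
    (hlim : ∀ᵐ x, Tendsto (fun n => φ n x) atTop (𝓝 (g ‖x‖))) {B : ENNReal}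
    (hB : Tendsto (fun n => ∫⁻ x, ‖cgrad (φ n) x‖ₑ ^ 2 ∂(hardyMeasure N)) atTop (𝓝 B)) :
    ∃ G : Set ℝ, (∀ᵐ r ∂volume.restrict (Set.Ioi (0 : ℝ)), r ∈ G) ∧
      ∀ r ∈ G, ∀ s ∈ G, 0 < s → s ≤ r →
        sphereMeasure N Set.univ * ‖g r - g s‖ₑ ^ 2 ≤ ENNReal.ofReal (Real.log (r / s)) * B := by
  have : Nonempty (Fin N) := ⟨⟨0, by omega⟩⟩
  -- The good radii are those on whose sphere the test functions converge in almost every direction.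
  refine ⟨{r | 0 < r ∧ ∀ᵐ θ : Metric.sphere (0 : EuclideanSpace ℝ (Fin N)) 1 ∂(sphereMeasure N),
    Tendsto (fun n => φ n (r • (θ : EuclideanSpace ℝ (Fin N)))) atTop (𝓝 (g r))}, ?_, ?_⟩
  · filter_upwards [ae_polar _ hlim, ae_restrict_mem measurableSet_Ioi] with r hr hr0
    refine ⟨hr0, ?_⟩
    filter_upwards [hr] with θ hθ
    simpa [norm_smul, abs_of_pos hr0.out] using hθ
  · rintro r ⟨hr0, hr⟩ s ⟨-, hs⟩ hs0 hsr
    have h1 : sphereMeasure N Set.univ * ‖g r - g s‖ₑ ^ 2 =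
        ∫⁻ _ : Metric.sphere (0 : EuclideanSpace ℝ (Fin N)) 1,
          ‖g r - g s‖ₑ ^ 2 ∂(sphereMeasure N) := by
      rw [lintegral_const, mul_comm]
    have h2 : ∫⁻ _ : Metric.sphere (0 : EuclideanSpace ℝ (Fin N)) 1,
          ‖g r - g s‖ₑ ^ 2 ∂(sphereMeasure N) =
        ∫⁻ θ : Metric.sphere (0 : EuclideanSpace ℝ (Fin N)) 1,
          liminf (fun n => ‖φ n (r • (θ : EuclideanSpace ℝ (Fin N))) -
            φ n (s • (θ : EuclideanSpace ℝ (Fin N)))‖ₑ ^ 2) atTop ∂(sphereMeasure N) := by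
      refine lintegral_congr_ae ?_
      filter_upwards [hr, hs] with θ h3 h4
      have h5 : Tendsto (fun n => ‖φ n (r • (θ : EuclideanSpace ℝ (Fin N))) -
            φ n (s • (θ : EuclideanSpace ℝ (Fin N)))‖ₑ ^ 2) atTop (𝓝 (‖g r - g s‖ₑ ^ 2)) :=
        ((ENNReal.continuous_pow 2).tendsto _).comp (h3.sub h4).enorm
      exact h5.liminf_eq.symm
    have hm : ∀ n, Measurable fun θ : Metric.sphere (0 : EuclideanSpace ℝ (Fin N)) 1 =>
        ‖φ n (r • (θ : EuclideanSpace ℝ (Fin N))) -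
            φ n (s • (θ : EuclideanSpace ℝ (Fin N)))‖ₑ ^ 2 := by
      intro n
      have := (hφ n).1.continuous
      have h : Continuous fun θ : Metric.sphere (0 : EuclideanSpace ℝ (Fin N)) 1 =>
        φ n (r • (θ : EuclideanSpace ℝ (Fin N))) - φ n (s • (θ : EuclideanSpace ℝ (Fin N))) := by
        fun_prop
      exact h.enorm.measurable.pow_const 2
    rw [h1, h2]
    -- Fatou on the sphere; the bound for each test function depends on it only through its energy,
    -- which tends to `B`.
    refine (lintegral_liminf_le hm).trans ?_
    have h6 := ENNReal.Tendsto.const_mul (a := ENNReal.ofReal (Real.log (r / s))) hB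
      (Or.inr ENNReal.ofReal_ne_top)
    rw [← h6.liminf_eq]
    exact liminf_le_liminf (Eventually.of_forall fun n =>
      lintegral_sphere_sub_sq_le hN (hφ n) hs0 hsr)

/-- `v` is radial and its profile is controlled logarithmically on a conull set of radii. -/
def HasLogProfile {N : ℕ} (K b : ℝ) (v : EuclideanSpace ℝ (Fin N) → ℂ) : Prop :=
  ∃ (g : ℝ → ℂ) (G : Set ℝ), (∀ r ∈ G, 0 < r) ∧ (∀ᵐ x, ‖x‖ ∈ G ∧ v x = g ‖x‖) ∧
    (∀ r ∈ G, ∀ s ∈ G, ‖g r - g s‖ ^ 2 ≤ K * |Real.log r - Real.log s| * b ^ 2) ∧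
    ∀ r ∈ G, ‖g r‖ ^ 2 ≤ K * (1 + |Real.log r|) * b ^ 2

/-- Averaging `|v|²` over this annulus needs its weight to be positive and finite. -/
theorem hardyMeasure_annulus_ne {N : ℕ} (hN : 3 ≤ N) :
    hardyMeasure N {x | 1 < ‖x‖ ∧ ‖x‖ < 2} ≠ 0 ∧ hardyMeasure N {x | 1 < ‖x‖ ∧ ‖x‖ < 2} ≠ ⊤ := by
  have : Nonempty (Fin N) := ⟨⟨0, by omega⟩⟩
  have ho : IsOpen {x : EuclideanSpace ℝ (Fin N) | 1 < ‖x‖ ∧ ‖x‖ < 2} :=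
    (isOpen_lt continuous_const continuous_norm).inter (isOpen_lt continuous_norm continuous_const)
  constructor
  · intro h
    have h1 := volume_absolutelyContinuous_powerMeasure hN _ h
    obtain ⟨x, hx⟩ := exists_norm_eq (EuclideanSpace ℝ (Fin N)) (c := 3 / 2) (by norm_num)
    refine (ho.measure_ne_zero volume ⟨x, ?_⟩) h1
    simp only [Set.mem_ofPred_eq, hx]
    norm_num
  · have hb : volume {x : EuclideanSpace ℝ (Fin N) | 1 < ‖x‖ ∧ ‖x‖ < 2} < ⊤ :=
      (measure_mono fun x hx => by simpa using hx.2).trans_lt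
        (measure_ball_lt_top (x := (0 : EuclideanSpace ℝ (Fin N))) (r := 2))
    rw [hardyMeasure, powerMeasure, withDensity_apply _ ho.measurableSet]
    refine ((setLIntegral_mono (g := fun _ => 1) measurable_const fun x hx => ?_).trans_lt
      (by simpa using hb)).ne
    rw [← ENNReal.ofReal_one]
    refine ENNReal.ofReal_le_ofReal (Real.rpow_le_one_of_one_le_of_nonpos hx.1.le ?_)
    have : (3 : ℝ) ≤ N := by exact_mod_cast hN
    linarith

/-- The modulus of continuity controls differences only; an anchor radius, found by averaging the
`L²` bound over a fixed annulus, turns it into a bound on the profile. -/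
theorem exists_hasLogProfile {N : ℕ} (hN : 3 ≤ N) :
    ∃ K : ℝ, 0 < K ∧ ∀ (b : ℝ) (v : EuclideanSpace ℝ (Fin N) → ℂ)
      (φ : ℕ → EuclideanSpace ℝ (Fin N) → ℂ) (g : ℝ → ℂ) (B : ENNReal), 0 ≤ b → AEMeasurable v →
      (∀ n, IsTest (φ n)) → (∀ᵐ x, v x = g ‖x‖) →
      (∀ᵐ x, Tendsto (fun n => φ n x) atTop (𝓝 (v x))) →
      Tendsto (fun n => ∫⁻ x, ‖cgrad (φ n) x‖ₑ ^ 2 ∂(hardyMeasure N)) atTop (𝓝 B) →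
      B ≤ ENNReal.ofReal (b ^ 2) →
      ∫⁻ x, ‖v x‖ₑ ^ 2 ∂(hardyMeasure N) ≤ ENNReal.ofReal (b ^ 2) → HasLogProfile K b v := by
  have : Nonempty (Fin N) := ⟨⟨0, by omega⟩⟩
  obtain ⟨hA0, hAt⟩ := hardyMeasure_annulus_ne hN
  set A : Set (EuclideanSpace ℝ (Fin N)) := {x | 1 < ‖x‖ ∧ ‖x‖ < 2} with hA
  have hAm : MeasurableSet A := by
    rw [hA]; measurability
  set a : ℝ := (hardyMeasure N A).toReal with ha
  have ha0 : 0 < a := ENNReal.toReal_pos hA0 hAt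
  set σ : ℝ := (sphereMeasure N Set.univ).toReal with hσ
  have hσt : sphereMeasure N Set.univ ≠ ⊤ := measure_ne_top _ _
  have hσ0 : 0 < σ := ENNReal.toReal_pos (by
    rw [Ne, Measure.measure_univ_eq_zero]; exact Measure.toSphere_ne_zero _) hσt
  -- The factors `2` come from `|g r|² ≤ 2 |g r - g s|² + 2 |g s|²`; the first term costs `σ⁻¹`, the
  -- anchor value costs `a⁻¹`.
  refine ⟨2 * σ⁻¹ + 2 * a⁻¹, by positivity, ?_⟩
  intro b v φ g B hb hvm hφ hvg hlim hB hBb hvb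
  have hlim' : ∀ᵐ x, Tendsto (fun n => φ n x) atTop (𝓝 (g ‖x‖)) := by
    filter_upwards [hvg, hlim] with x h1 h2
    rwa [← h1]
  obtain ⟨G, hG, hGe⟩ := exists_conull_sphere_mul_sub_sq_le hN hφ hlim' hB
  have hle : ∀ r ∈ G, ∀ s ∈ G, 0 < s → s ≤ r →
      ‖g r - g s‖ ^ 2 ≤ σ⁻¹ * |Real.log r - Real.log s| * b ^ 2 := by
    intro r hr s hs hs0 hsr
    have h1 := (hGe r hr s hs hs0 hsr).trans (mul_le_mul_right hBb _)
    rw [← ofReal_norm, ← ENNReal.ofReal_pow (norm_nonneg _), ← ENNReal.ofReal_toReal hσt,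
      ← ENNReal.ofReal_mul ENNReal.toReal_nonneg, ← ENNReal.ofReal_mul
        (Real.log_nonneg ((one_le_div hs0).2 hsr)),
      ENNReal.ofReal_le_ofReal_iff (mul_nonneg (Real.log_nonneg ((one_le_div hs0).2 hsr))
        (sq_nonneg _)), Real.log_div (hs0.trans_le hsr).ne' hs0.ne'] at h1
    have h2 : Real.log r - Real.log s = |Real.log r - Real.log s| :=
      (abs_of_nonneg (sub_nonneg.2 (Real.log_le_log hs0 hsr))).symm
    rw [h2] at h1
    rw [mul_assoc, inv_mul_eq_div, le_div_iff₀ hσ0]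
    linarith
  have hle' : ∀ r ∈ G, ∀ s ∈ G, 0 < r → 0 < s →
      ‖g r - g s‖ ^ 2 ≤ σ⁻¹ * |Real.log r - Real.log s| * b ^ 2 := by
    intro r hr s hs hr0 hs0
    rcases le_total s r with h | h
    · exact hle r hr s hs hs0 h
    · rw [norm_sub_rev, abs_sub_comm]
      exact hle s hs r hr hr0 h
  have hpos : ∀ᵐ x : EuclideanSpace ℝ (Fin N), ‖x‖ ∈ G ∧ 0 < ‖x‖ :=
    ae_comp_norm volume (Q := fun r => r ∈ G ∧ 0 < r) (by
      filter_upwards [hG, ae_restrict_mem measurableSet_Ioi] with r h1 h2 using ⟨h1, h2⟩)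
  -- Some point of the annulus, outside the null set of bad points, has `|v|²` at most its average;
  -- its norm is the anchor.
  obtain ⟨s, hsG, hs1, hs2, hsb⟩ : ∃ s ∈ G, 1 < s ∧ s < 2 ∧ ‖g s‖ ^ 2 ≤ a⁻¹ * b ^ 2 := by
    have hne : (hardyMeasure N).restrict A ≠ 0 := by
      rwa [Ne, Measure.restrict_eq_zero]
    have : IsFiniteMeasure ((hardyMeasure N).restrict A) :=
      ⟨by simpa using lt_top_iff_ne_top.2 hAt⟩
    have hae : ∀ᵐ x ∂(hardyMeasure N).restrict A, x ∈ A ∧ ‖x‖ ∈ G ∧ v x = g ‖x‖ := by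
      filter_upwards [ae_restrict_mem hAm, ae_restrict_of_ae
        ((powerMeasure_absolutelyContinuous_volume _).ae_le hpos), ae_restrict_of_ae
        ((powerMeasure_absolutelyContinuous_volume _).ae_le hvg)] with x h1 h2 h3
      exact ⟨h1, h2.1, h3⟩
    have hvm' : AEMeasurable (fun x => ‖v x‖ₑ ^ 2) ((hardyMeasure N).restrict A) :=
      ((hvm.mono_ac (powerMeasure_absolutelyContinuous_volume _)).mono_measure
        Measure.restrict_le_self).enorm.pow_const 2
    obtain ⟨x, hx, hxle⟩ := exists_notMem_null_le_laverage hne hvm' (ae_iff.1 hae)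
    simp only [Set.mem_ofPred_eq, not_not] at hx
    obtain ⟨⟨h1, h2⟩, h3, h4⟩ := hx
    refine ⟨‖x‖, h3, h1, h2, ?_⟩
    rw [← h4]
    rw [laverage_eq, Measure.restrict_apply_univ] at hxle
    have h5 : ‖v x‖ₑ ^ 2 ≤ ENNReal.ofReal (b ^ 2) / hardyMeasure N A :=
      hxle.trans (ENNReal.div_le_div_right
        ((setLIntegral_le_lintegral _ _).trans hvb) _)
    rw [← ENNReal.ofReal_toReal hAt, ← ENNReal.ofReal_div_of_pos ha0, ← ofReal_norm,
      ← ENNReal.ofReal_pow (norm_nonneg _), ENNReal.ofReal_le_ofReal_iff (by positivity)] at h5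
    rwa [inv_mul_eq_div]
  refine ⟨g, {r | r ∈ G ∧ 0 < r}, fun r hr => hr.2, ?_, ?_, ?_⟩
  · filter_upwards [hpos, hvg] with x h1 h2 using ⟨h1, h2⟩
  · rintro r ⟨hr, hr0⟩ t ⟨ht, ht0⟩
    refine (hle' r hr t ht hr0 ht0).trans ?_
    gcongr
    have : 0 < σ⁻¹ := by positivity
    have : 0 < a⁻¹ := by positivity
    linarith
  · rintro r ⟨hr, hr0⟩
    have h1 := hle' r hr s hsG hr0 (by linarith)
    have h2 : ‖g r‖ ≤ ‖g r - g s‖ + ‖g s‖ := by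
      simpa using norm_add_le (g r - g s) (g s)
    have h3 : ‖g r‖ ^ 2 ≤ 2 * ‖g r - g s‖ ^ 2 + 2 * ‖g s‖ ^ 2 := by
      nlinarith [sq_nonneg (‖g r - g s‖ - ‖g s‖), norm_nonneg (g r)]
    -- The anchor lies in `(1, 2)`, so `0 ≤ log s ≤ s - 1 < 1`.
    have h4 : |Real.log r - Real.log s| ≤ 1 + |Real.log r| := by
      have h5 : 0 ≤ Real.log s := Real.log_nonneg hs1.le
      have h6 : Real.log s ≤ s - 1 := Real.log_le_sub_one_of_pos (by linarith)
      refine (abs_sub _ _).trans ?_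
      rw [abs_of_nonneg h5]
      linarith
    have h7 : σ⁻¹ * |Real.log r - Real.log s| * b ^ 2 ≤ σ⁻¹ * (1 + |Real.log r|) * b ^ 2 := by
      gcongr
    have h8 : a⁻¹ * b ^ 2 ≤ a⁻¹ * (1 + |Real.log r|) * b ^ 2 := by
      have : 0 ≤ a⁻¹ * b ^ 2 * |Real.log r| := by positivity
      nlinarith
    calc ‖g r‖ ^ 2 ≤ 2 * (σ⁻¹ * (1 + |Real.log r|) * b ^ 2) +
          2 * (a⁻¹ * (1 + |Real.log r|) * b ^ 2) := by linarith
      _ = _ := by ring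

/-! ### Uniform tail estimates and the integral bound -/

theorem one_add_abs_log_le_of_le_one {ε r : ℝ} (hε : 0 < ε) (hr : 0 < r) (hr1 : r ≤ 1) :
    1 + |Real.log r| ≤ (1 + ε⁻¹) * r ^ (-ε) := by
  have h1 : Real.log (r⁻¹) ≤ (r⁻¹) ^ ε / ε := Real.log_le_rpow_div (by positivity) hε
  have h2 : (r⁻¹) ^ ε = r ^ (-ε) := by rw [Real.rpow_neg hr.le, Real.inv_rpow hr.le]
  have h3 : 1 ≤ r ^ (-ε) := Real.one_le_rpow_of_pos_of_le_one_of_nonpos hr hr1 (by linarith)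
  rw [abs_of_nonpos (Real.log_nonpos hr.le hr1), ← Real.log_inv, add_mul, one_mul,
    inv_mul_eq_div, ← h2]
  rw [← h2] at h3
  linarith

theorem one_add_abs_log_le_of_one_le {ε r : ℝ} (hε : 0 < ε) (hr1 : 1 ≤ r) :
    1 + |Real.log r| ≤ (1 + ε⁻¹) * r ^ ε := by
  have h1 : Real.log r ≤ r ^ ε / ε := Real.log_le_rpow_div (by positivity) hε
  have h3 : 1 ≤ r ^ ε := Real.one_le_rpow hr1 hε.le
  rw [abs_of_nonneg (Real.log_nonneg hr1), add_mul, one_mul, inv_mul_eq_div]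
  linarith

theorem lintegral_ball_norm_rpow_lt_top {N : ℕ} (hN : 3 ≤ N) {ρ : ℝ} (hρ : -(N : ℝ) < ρ) :
    ∫⁻ x in Metric.ball (0 : EuclideanSpace ℝ (Fin N)) 1, ENNReal.ofReal (‖x‖ ^ ρ) < ⊤ := by
  have : Nonempty (Fin N) := ⟨⟨0, by omega⟩⟩
  have h1 : IntegrableOn (fun x : EuclideanSpace ℝ (Fin N) => ‖x‖ ^ ρ)
      (Metric.ball 0 1) volume := by
    rw [integrableOn_fun_norm_addHaar volume (f := fun y : ℝ => y ^ ρ)]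
    have h2 : IntegrableOn (fun y : ℝ => y ^ ((N : ℝ) - 1 + ρ)) (Set.Ioo 0 1) :=
      (intervalIntegral.integrableOn_Ioo_rpow_iff one_pos).2 (by linarith)
    refine h2.congr_fun (fun y hy => ?_) measurableSet_Ioo
    simp only [finrank_euclideanSpace_fin, smul_eq_mul]
    rw [← Real.rpow_natCast, ← Real.rpow_add hy.1, Nat.cast_sub (by omega)]
    norm_num
  exact h1.lintegral_lt_top

/-- The annulus `e^{-M} ≤ |x| < e^M`. -/
def annulus (N M : ℕ) : Set (EuclideanSpace ℝ (Fin N)) :=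
  {x | Real.exp (-M) ≤ ‖x‖ ∧ ‖x‖ < Real.exp M}

theorem measurableSet_annulus (N M : ℕ) : MeasurableSet (annulus N M) := by
  unfold annulus
  measurability

theorem lintegral_annulus_norm_rpow_lt_top (N M : ℕ) (ρ : ℝ) :
    ∫⁻ x in annulus N M, ENNReal.ofReal (‖x‖ ^ ρ) < ⊤ := by
  have hfin : volume (annulus N M) < ⊤ :=
    (measure_mono fun x hx => by simpa using hx.2).trans_lt
      (measure_ball_lt_top (x := (0 : EuclideanSpace ℝ (Fin N))) (r := Real.exp M))
  refine (setLIntegral_mono (g := fun _ => ENNReal.ofReal (Real.exp (M * |ρ|))) measurable_const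
    fun x hx => ENNReal.ofReal_le_ofReal ?_).trans_lt ?_
  · have h0 : 0 < ‖x‖ := (Real.exp_pos _).trans_le hx.1
    rw [Real.rpow_def_of_pos h0]
    refine Real.exp_le_exp.2 ((le_abs_self _).trans ?_)
    rw [abs_mul]
    gcongr
    rw [abs_le, Real.le_log_iff_exp_le h0, Real.log_le_iff_le_exp h0]
    exact ⟨hx.1, hx.2.le⟩
  · rw [setLIntegral_const]
    exact ENNReal.mul_lt_top ENNReal.ofReal_lt_top hfin

/-- The logarithm is traded for `r^{-ε}`, costing `r^{-εq/2}` in `V^q`. A further `r^ε ≤ δ^ε` is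
split off to produce smallness; the later choice of `ε` keeps the remaining exponent above `-N`. -/
theorem inner_bound {ε q τ K b V r δ : ℝ} (hε : 0 < ε) (hq : 0 < q) (hK : 0 ≤ K) (hb : 0 ≤ b)
    (hV : 0 ≤ V) (hr : 0 < r) (hrδ : r ≤ δ) (hδ : δ ≤ 1)
    (h : V ^ 2 ≤ K * (1 + |Real.log r|) * b ^ 2) :
    V ^ q * r ^ τ ≤ (K * (1 + ε⁻¹)) ^ (q / 2) * δ ^ ε * b ^ q * r ^ (τ - ε * q / 2 - ε) := by
  have h1 : V ^ 2 ≤ K * (1 + ε⁻¹) * r ^ (-ε) * b ^ 2 := by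
    refine h.trans ?_
    rw [mul_assoc K (1 + ε⁻¹)]
    gcongr
    exact one_add_abs_log_le_of_le_one hε hr (hrδ.trans hδ)
  have h2 : V ^ q ≤ (K * (1 + ε⁻¹)) ^ (q / 2) * r ^ (-(ε * q / 2)) * b ^ q := by
    have h3 := Real.rpow_le_rpow (by positivity) h1 (by positivity : 0 ≤ q / 2)
    rw [Real.mul_rpow (by positivity) (by positivity),
      Real.mul_rpow (by positivity) (by positivity), ← Real.rpow_mul hr.le,
      ← Real.rpow_natCast, ← Real.rpow_natCast, ← Real.rpow_mul hV, ← Real.rpow_mul hb] at h3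
    convert h3 using 3 <;> push_cast <;> ring_nf
  calc V ^ q * r ^ τ ≤ (K * (1 + ε⁻¹)) ^ (q / 2) * r ^ (-(ε * q / 2)) * b ^ q * r ^ τ := by
        gcongr
    _ = (K * (1 + ε⁻¹)) ^ (q / 2) * r ^ ε * b ^ q * r ^ (τ - ε * q / 2 - ε) := by
        have : r ^ (-(ε * q / 2)) * r ^ τ = r ^ ε * r ^ (τ - ε * q / 2 - ε) := by
          rw [← Real.rpow_add hr, ← Real.rpow_add hr]
          ring_nf
        linear_combination (K * (1 + ε⁻¹)) ^ (q / 2) * b ^ q * this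
    _ ≤ _ := by gcongr

/-- Here `d` stands for `N - 2`. From `V^q = V^{q-2} V²`, the factor `r^{-d} V²` is kept for the
`L²` norm, while `V^{q-2}` grows at most like `r^{ε(q-2)/2}` and is beaten by `r^{-d(q-2)/2}` since
`ε < d`. -/
theorem outer_bound {ε q d K b V r R : ℝ} (hε : 0 < ε) (hεd : ε < d) (hq : 2 < q) (hK : 0 ≤ K)
    (hb : 0 ≤ b) (hV : 0 ≤ V) (hR : 1 ≤ R) (hRr : R ≤ r)
    (h : V ^ 2 ≤ K * (1 + |Real.log r|) * b ^ 2) :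
    V ^ q * r ^ (-(d / 2 * q)) ≤ (K * (1 + ε⁻¹)) ^ ((q - 2) / 2) * R ^ (-((d - ε) * (q - 2) / 2)) *
      b ^ (q - 2) * (r ^ (-d) * V ^ 2) := by
  have hr : 0 < r := by linarith
  have h1 : V ^ 2 ≤ K * (1 + ε⁻¹) * r ^ ε * b ^ 2 := by
    refine h.trans ?_
    rw [mul_assoc K (1 + ε⁻¹)]
    gcongr
    exact one_add_abs_log_le_of_one_le hε (hR.trans hRr)
  have h2 : V ^ (q - 2) ≤ (K * (1 + ε⁻¹)) ^ ((q - 2) / 2) * r ^ (ε * (q - 2) / 2) *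
      b ^ (q - 2) := by
    have h3 := Real.rpow_le_rpow (by positivity) h1 (by linarith : 0 ≤ (q - 2) / 2)
    rw [Real.mul_rpow (by positivity) (by positivity),
      Real.mul_rpow (by positivity) (by positivity), ← Real.rpow_mul hr.le,
      ← Real.rpow_natCast, ← Real.rpow_natCast, ← Real.rpow_mul hV, ← Real.rpow_mul hb] at h3
    convert h3 using 3 <;> push_cast <;> ring_nf
  have h4 : V ^ q = V ^ (q - 2) * V ^ 2 := by
    rw [← Real.rpow_natCast V 2, ← Real.rpow_add' hV (by push_cast; linarith)]
    push_cast; ring_nf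
  have h5 : r ^ (ε * (q - 2) / 2) * r ^ (-(d / 2 * q)) =
      r ^ (-((d - ε) * (q - 2) / 2)) * r ^ (-d) := by
    rw [← Real.rpow_add hr, ← Real.rpow_add hr]
    ring_nf
  have h6 : r ^ (-((d - ε) * (q - 2) / 2)) ≤ R ^ (-((d - ε) * (q - 2) / 2)) := by
    refine Real.rpow_le_rpow_of_nonpos (by linarith) hRr ?_
    have := mul_nonneg (sub_nonneg.2 hεd.le) (sub_nonneg.2 hq.le)
    linarith
  calc V ^ q * r ^ (-(d / 2 * q)) = V ^ (q - 2) * V ^ 2 * r ^ (-(d / 2 * q)) := by rw [h4]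
    _ ≤ (K * (1 + ε⁻¹)) ^ ((q - 2) / 2) * r ^ (ε * (q - 2) / 2) *
      b ^ (q - 2) * V ^ 2 * r ^ (-(d / 2 * q)) := by gcongr
    _ = (K * (1 + ε⁻¹)) ^ ((q - 2) / 2) * r ^ (-((d - ε) * (q - 2) / 2)) *
      b ^ (q - 2) * (r ^ (-d) * V ^ 2) := by
        linear_combination (K * (1 + ε⁻¹)) ^ ((q - 2) / 2) * b ^ (q - 2) * V ^ 2 * h5
    _ ≤ _ := by gcongr

theorem exists_lintegral_compl_annulus_le {N : ℕ} (hN : 3 ≤ N) {q : ℝ} (hq : 2 < q)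
    (hq' : q < 2 * (N : ℝ) / ((N : ℝ) - 2)) {K : ℝ} (hK : 0 ≤ K) {η : ℝ} (hη : 0 < η) :
    ∃ M : ℕ, ∀ (b : ℝ) (v : EuclideanSpace ℝ (Fin N) → ℂ), 0 ≤ b → HasLogProfile K b v →
      AEMeasurable v → ∫⁻ x, ‖v x‖ₑ ^ 2 ∂(hardyMeasure N) ≤ ENNReal.ofReal (b ^ 2) →
      ∫⁻ x in (annulus N M)ᶜ, ENNReal.ofReal (‖v x‖ ^ q * ‖x‖ ^ (-(((N : ℝ) - 2) / 2 * q))) ≤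
        ENNReal.ofReal (η * b ^ q) := by
  have hN3 : (3 : ℝ) ≤ N := by exact_mod_cast hN
  have hgap : 0 < N - ((N : ℝ) - 2) / 2 * q := by
    rw [lt_div_iff₀ (by linarith)] at hq'
    linarith
  -- Decay at infinity asks for `ε < N - 2`, which `1/2` meets since `N ≥ 3`; integrability at the
  -- origin asks that `ε (q/2 + 1)` fit in the gap left by `q < 2*`.
  obtain ⟨ε, hε, hε1, hεq⟩ : ∃ ε : ℝ, 0 < ε ∧ ε < N - 2 ∧
      ε * (q / 2 + 1) < N - ((N : ℝ) - 2) / 2 * q := by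
    refine ⟨min (1 / 2) ((N - ((N : ℝ) - 2) / 2 * q) / (q / 2 + 1) / 2), ?_, ?_, ?_⟩
    · have : 0 < q / 2 + 1 := by linarith
      positivity
    · exact (min_le_left _ _).trans_lt (by linarith)
    · have : 0 < q / 2 + 1 := by linarith
      rw [← lt_div_iff₀ this]
      exact (min_le_right _ _).trans_lt (half_lt_self (by positivity))
  set τ : ℝ := -(((N : ℝ) - 2) / 2 * q) with hτ
  set ρ : ℝ := τ - ε * q / 2 - ε with hρ
  have hI := lintegral_ball_norm_rpow_lt_top hN (ρ := ρ) (by rw [hρ, hτ]; linarith)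
  set I := (∫⁻ x in Metric.ball (0 : EuclideanSpace ℝ (Fin N)) 1, ENNReal.ofReal (‖x‖ ^ ρ)).toReal
    with hIdef
  set κ : ℝ := ((N - 2) - ε) * (q - 2) / 2 with hκ
  have hκ0 : 0 < κ := by
    have := mul_pos (sub_pos.2 hε1) (sub_pos.2 hq)
    rw [hκ]; linarith
  set D : ℝ := K * (1 + ε⁻¹) with hD
  have hD0 : 0 ≤ D := by positivity
  -- The constants of the inner and outer tails both vanish as `M` grows, independently of `v`.
  have hlim : Tendsto (fun M : ℕ => D ^ (q / 2) * Real.exp (-M) ^ ε * I +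
      D ^ ((q - 2) / 2) * Real.exp M ^ (-κ)) atTop (𝓝 (D ^ (q / 2) * 0 * I +
      D ^ ((q - 2) / 2) * 0)) := by
    have h (c : ℝ) (hc : 0 < c) : Tendsto (fun M : ℕ => Real.exp (-(M * c))) atTop (𝓝 0) :=
      Real.tendsto_exp_neg_atTop_nhds_zero.comp
        (tendsto_natCast_atTop_atTop.atTop_mul_const hc)
    have h1 : Tendsto (fun M : ℕ => Real.exp (-M) ^ ε) atTop (𝓝 0) := by
      refine (h ε hε).congr fun M => ?_
      rw [← Real.exp_mul]; ring_nf
    have h2 : Tendsto (fun M : ℕ => Real.exp M ^ (-κ)) atTop (𝓝 0) := by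
      refine (h κ hκ0).congr fun M => ?_
      rw [← Real.exp_mul]; ring_nf
    exact ((h1.const_mul _).mul_const _).add (h2.const_mul _)
  simp only [mul_zero, zero_mul, add_zero] at hlim
  obtain ⟨M, hM⟩ := (hlim.eventually (gt_mem_nhds hη)).exists
  refine ⟨M, fun b v hb hv hvm hvb => ?_⟩
  obtain ⟨g, G, hG0, hGv, -, hGb⟩ := hv
  have hδ1 : Real.exp (-(M : ℝ)) ≤ 1 := Real.exp_le_one_iff.2 (by simp)
  have hR1 : 1 ≤ Real.exp (M : ℝ) := Real.one_le_exp (by simp)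
  set c1 : ℝ := D ^ (q / 2) * Real.exp (-M) ^ ε * b ^ q with hc1
  set c2 : ℝ := D ^ ((q - 2) / 2) * Real.exp M ^ (-κ) * b ^ (q - 2) with hc2
  have hpt : ∀ᵐ x ∂(volume.restrict (annulus N M)ᶜ),
      ENNReal.ofReal (‖v x‖ ^ q * ‖x‖ ^ τ) ≤
        ENNReal.ofReal c1 * (Metric.ball (0 : EuclideanSpace ℝ (Fin N)) 1).indicator
          (fun x => ENNReal.ofReal (‖x‖ ^ ρ)) x +
        ENNReal.ofReal c2 * (ENNReal.ofReal (‖x‖ ^ (-((N : ℝ) - 2))) * ‖v x‖ₑ ^ 2) := by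
    filter_upwards [ae_restrict_of_ae hGv, ae_restrict_mem (measurableSet_annulus N M).compl]
      with x hx hxM
    obtain ⟨hxG, hxv⟩ := hx
    have hx0 := hG0 _ hxG
    have hb2 := hGb _ hxG
    rw [← hxv] at hb2
    by_cases hxδ : ‖x‖ < Real.exp (-(M : ℝ))
    · refine le_trans ?_ le_self_add
      rw [Set.indicator_of_mem (by simpa using hxδ.trans_le hδ1),
        ← ENNReal.ofReal_mul (by positivity)]
      exact ENNReal.ofReal_le_ofReal (inner_bound hε (by linarith) hK hb (norm_nonneg _) hx0
        hxδ.le hδ1 hb2)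
    · have hxR : Real.exp (M : ℝ) ≤ ‖x‖ := by
        by_contra h
        exact hxM ⟨not_lt.1 hxδ, not_le.1 h⟩
      refine le_trans ?_ le_add_self
      rw [← ofReal_norm, ← ENNReal.ofReal_pow (norm_nonneg _),
        ← ENNReal.ofReal_mul (by positivity), ← ENNReal.ofReal_mul (by positivity)]
      exact ENNReal.ofReal_le_ofReal (outer_bound hε hε1 hq hK hb (norm_nonneg _) hR1 hxR hb2)
  -- In the outer tail `b^{q-2}` is pointwise and `b²` comes from the `L²` norm; together they
  -- restore homogeneity of degree `q`.
  have hb3 : b ^ q = b ^ (q - 2) * b ^ 2 := by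
    rw [← Real.rpow_natCast b 2, ← Real.rpow_add' hb (by push_cast; linarith)]
    push_cast; ring_nf
  calc ∫⁻ x in (annulus N M)ᶜ, ENNReal.ofReal (‖v x‖ ^ q * ‖x‖ ^ τ)
      ≤ ∫⁻ x in (annulus N M)ᶜ, (ENNReal.ofReal c1 *
          (Metric.ball (0 : EuclideanSpace ℝ (Fin N)) 1).indicator
          (fun x => ENNReal.ofReal (‖x‖ ^ ρ)) x +
        ENNReal.ofReal c2 * (ENNReal.ofReal (‖x‖ ^ (-((N : ℝ) - 2))) * ‖v x‖ₑ ^ 2)) :=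
        lintegral_mono_ae hpt
    _ ≤ ∫⁻ x, (ENNReal.ofReal c1 *
          (Metric.ball (0 : EuclideanSpace ℝ (Fin N)) 1).indicator
          (fun x => ENNReal.ofReal (‖x‖ ^ ρ)) x +
        ENNReal.ofReal c2 * (ENNReal.ofReal (‖x‖ ^ (-((N : ℝ) - 2))) * ‖v x‖ₑ ^ 2)) :=
        setLIntegral_le_lintegral _ _
    _ = ENNReal.ofReal c1 * ENNReal.ofReal I +
        ENNReal.ofReal c2 * ∫⁻ x, ‖v x‖ₑ ^ 2 ∂(hardyMeasure N) := by
      have hm : Measurable ((Metric.ball (0 : EuclideanSpace ℝ (Fin N)) 1).indicator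
          (fun x => ENNReal.ofReal (‖x‖ ^ ρ))) :=
        (measurable_norm_rpow ρ).indicator Metric.isOpen_ball.measurableSet
      rw [lintegral_add_left (hm.const_mul _), lintegral_const_mul' _ _ ENNReal.ofReal_ne_top,
        lintegral_const_mul' _ _ ENNReal.ofReal_ne_top,
        lintegral_indicator Metric.isOpen_ball.measurableSet, ENNReal.ofReal_toReal hI.ne,
        lintegral_powerMeasure _ (hvm.enorm.pow_const 2)]
    _ ≤ ENNReal.ofReal c1 * ENNReal.ofReal I + ENNReal.ofReal c2 * ENNReal.ofReal (b ^ 2) := by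
      gcongr
    _ = ENNReal.ofReal ((D ^ (q / 2) * Real.exp (-M) ^ ε * I +
        D ^ ((q - 2) / 2) * Real.exp M ^ (-κ)) * b ^ q) := by
      have hI0 : 0 ≤ I := ENNReal.toReal_nonneg
      rw [← ENNReal.ofReal_mul (by positivity), ← ENNReal.ofReal_mul (by positivity),
        ← ENNReal.ofReal_add (by positivity) (by positivity), hc1, hc2]
      congr 1
      linear_combination (-(D ^ ((q - 2) / 2) * Real.exp M ^ (-κ))) * hb3
    _ ≤ ENNReal.ofReal (η * b ^ q) := by
      refine ENNReal.ofReal_le_ofReal ?_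
      gcongr

theorem lintegral_annulus_le {N M : ℕ} {q τ c : ℝ} (hq : 0 ≤ q)
    {h : EuclideanSpace ℝ (Fin N) → ℂ} (hh : ∀ᵐ x, x ∈ annulus N M → ‖h x‖ ≤ c) :
    ∫⁻ x in annulus N M, ENNReal.ofReal (‖h x‖ ^ q * ‖x‖ ^ τ) ≤
      ENNReal.ofReal (c ^ q) * ∫⁻ x in annulus N M, ENNReal.ofReal (‖x‖ ^ τ) := by
  rw [← lintegral_const_mul' _ _ ENNReal.ofReal_ne_top]
  refine lintegral_mono_ae ?_
  filter_upwards [ae_restrict_of_ae hh, ae_restrict_mem (measurableSet_annulus N M)] with x h1 h2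
  rw [← ENNReal.ofReal_mul (Real.rpow_nonneg ((norm_nonneg _).trans (h1 h2)) _)]
  refine ENNReal.ofReal_le_ofReal ?_
  gcongr
  exact h1 h2

theorem abs_log_norm_le_of_mem_annulus {N M : ℕ} {x : EuclideanSpace ℝ (Fin N)}
    (hx : x ∈ annulus N M) : |Real.log ‖x‖| ≤ M := by
  have h0 : 0 < ‖x‖ := (Real.exp_pos _).trans_le hx.1
  rw [abs_le, Real.le_log_iff_exp_le h0, Real.log_le_iff_le_exp h0]
  exact ⟨hx.1, hx.2.le⟩

/-- The tail estimate with `η = 1`, plus the bound `√(K (1 + M)) b` for `|v|` on the annulus.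
Homogeneity of degree `q` in `b` is what later gives a linear norm bound. -/
theorem exists_lintegral_le_of_hasLogProfile {N : ℕ} (hN : 3 ≤ N) {q : ℝ} (hq : 2 < q)
    (hq' : q < 2 * (N : ℝ) / ((N : ℝ) - 2)) {K : ℝ} (hK : 0 ≤ K) :
    ∃ C : ℝ, 0 ≤ C ∧ ∀ (b : ℝ) (v : EuclideanSpace ℝ (Fin N) → ℂ), 0 ≤ b → HasLogProfile K b v →
      AEMeasurable v → ∫⁻ x, ‖v x‖ₑ ^ 2 ∂(hardyMeasure N) ≤ ENNReal.ofReal (b ^ 2) →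
      ∫⁻ x, ENNReal.ofReal (‖v x‖ ^ q * ‖x‖ ^ (-(((N : ℝ) - 2) / 2 * q))) ≤
        ENNReal.ofReal (C * b ^ q) := by
  obtain ⟨M, hM⟩ := exists_lintegral_compl_annulus_le hN hq hq' hK one_pos
  set τ : ℝ := -(((N : ℝ) - 2) / 2 * q) with hτ
  have hW := lintegral_annulus_norm_rpow_lt_top N M τ
  set W : ℝ := (∫⁻ x in annulus N M, ENNReal.ofReal (‖x‖ ^ τ)).toReal with hWdef
  have hW0 : 0 ≤ W := ENNReal.toReal_nonneg
  refine ⟨√(K * (1 + M)) ^ q * W + 1, by positivity, fun b v hb hv hvm hvb => ?_⟩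
  have h1 := hM b v hb hv hvm hvb
  obtain ⟨g, G, hG0, hGv, -, hGb⟩ := hv
  have h2 := lintegral_annulus_le (N := N) (M := M) (q := q) (τ := τ) (c := √(K * (1 + M)) * b)
    (h := v) (by linarith) (by
      filter_upwards [hGv] with x hx hxM
      rw [← Real.sqrt_sq (norm_nonneg (v x)), ← Real.sqrt_sq hb, ← Real.sqrt_mul (by positivity)]
      refine Real.sqrt_le_sqrt ?_
      rw [hx.2]
      refine (hGb _ hx.1).trans ?_
      gcongr
      exact abs_log_norm_le_of_mem_annulus hxM)
  rw [← ENNReal.ofReal_toReal hW.ne, ← ENNReal.ofReal_mul (by positivity)] at h2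
  rw [← lintegral_add_compl _ (measurableSet_annulus N M)]
  refine (add_le_add h2 h1).trans ?_
  rw [← ENNReal.ofReal_add (by positivity) (by positivity),
    Real.mul_rpow (by positivity) hb]
  refine ENNReal.ofReal_le_ofReal (le_of_eq ?_)
  ring

/-! ### Approximation by step functions -/

/-- The index of the logarithmic cell of width `1/n` that contains `|x|`. -/
def logCell {N : ℕ} (n : ℕ) (x : EuclideanSpace ℝ (Fin N)) : ℤ := ⌊(n : ℝ) * Real.log ‖x‖⌋

theorem measurable_logCell {N : ℕ} (n : ℕ) :
    Measurable (logCell n : EuclideanSpace ℝ (Fin N) → ℤ) := by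
  unfold logCell
  exact Int.measurable_floor.comp (by fun_prop)

theorem logCell_mem_Ico {N M n : ℕ} (hn : 0 < n) {x : EuclideanSpace ℝ (Fin N)}
    (hx : x ∈ annulus N M) : logCell n x ∈ Finset.Ico (-(n * M : ℤ)) (n * M) := by
  have h0 : 0 < ‖x‖ := (Real.exp_pos _).trans_le hx.1
  have h1 : -(M : ℝ) ≤ Real.log ‖x‖ := (Real.le_log_iff_exp_le h0).2 hx.1
  have h2 : Real.log ‖x‖ < M := (Real.log_lt_iff_lt_exp h0).2 hx.2
  have hn' : (0 : ℝ) < n := by exact_mod_cast hn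
  rw [Finset.mem_Ico, logCell, Int.le_floor, Int.floor_lt]
  push_cast
  constructor
  · nlinarith
  · nlinarith

/-- On a cell of logarithmic width `1/n` the profile oscillates by at most `√(K/n)` when `b ≤ 1`. As
`M` and `n` do not depend on `v`, all step functions used come from one finite set of cells with a
common bound on the values. -/
theorem exists_step_approx {N : ℕ} (hN : 3 ≤ N) {q : ℝ} (hq : 2 < q)
    (hq' : q < 2 * (N : ℝ) / ((N : ℝ) - 2)) {K : ℝ} (hK : 0 ≤ K) {η : ℝ} (hη : 0 < η) :
    ∃ M n : ℕ, 0 < n ∧ ∀ (b : ℝ) (v : EuclideanSpace ℝ (Fin N) → ℂ), 0 ≤ b → b ≤ 1 →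
      HasLogProfile K b v → AEMeasurable v →
      ∫⁻ x, ‖v x‖ₑ ^ 2 ∂(hardyMeasure N) ≤ ENNReal.ofReal (b ^ 2) →
      ∃ c : ℤ → ℂ, (∀ k ∈ Finset.Ico (-(n * M : ℤ)) (n * M), ‖c k‖ ≤ √(K * (1 + M))) ∧
        ∫⁻ x, ENNReal.ofReal (‖v x - (annulus N M).indicator (fun x => c (logCell n x)) x‖ ^ q *
          ‖x‖ ^ (-(((N : ℝ) - 2) / 2 * q))) ≤ ENNReal.ofReal η := by
  obtain ⟨M, hM⟩ := exists_lintegral_compl_annulus_le hN hq hq' hK (half_pos hη)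
  set τ : ℝ := -(((N : ℝ) - 2) / 2 * q) with hτ
  have hW := lintegral_annulus_norm_rpow_lt_top N M τ
  set W : ℝ := (∫⁻ x in annulus N M, ENNReal.ofReal (‖x‖ ^ τ)).toReal with hWdef
  have hlim : Tendsto (fun n : ℕ => √(K / n) ^ q * W) atTop (𝓝 (√0 ^ q * W)) := by
    have h1 : Tendsto (fun n : ℕ => √(K / n)) atTop (𝓝 √0) :=
      (Real.continuous_sqrt.tendsto _).comp (tendsto_const_div_atTop_nhds_zero_nat K)
    exact (h1.rpow_const (Or.inr (by linarith))).mul_const _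
  rw [Real.sqrt_zero, Real.zero_rpow (by linarith), zero_mul] at hlim
  obtain ⟨n, hn, hn0⟩ := ((hlim.eventually (gt_mem_nhds (half_pos hη))).and
    (eventually_gt_atTop 0)).exists
  have hn' : (0 : ℝ) < n := by exact_mod_cast hn0
  refine ⟨M, n, hn0, fun b v hb hb1 hv hvm hvb => ?_⟩
  have h1 := hM b v hb hv hvm hvb
  have hbq : b ^ q ≤ 1 := Real.rpow_le_one hb hb1 (by linarith)
  have hbs : b ^ 2 ≤ 1 := pow_le_one₀ hb hb1
  obtain ⟨g, G, hG0, hGv, hGd, hGb⟩ := hv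
  classical
  -- The sampling radius must lie in `G`, the only place where `g` is controlled; cells that miss
  -- `G` get the value `0`.
  let c : ℤ → ℂ := fun k =>
    if h : ∃ r ∈ G, ⌊(n : ℝ) * Real.log r⌋ = k then g h.choose else 0
  have hc : ∀ r ∈ G, ‖g r - c ⌊(n : ℝ) * Real.log r⌋‖ ≤ √(K / n) := by
    intro r hr
    have h : ∃ s ∈ G, ⌊(n : ℝ) * Real.log s⌋ = ⌊(n : ℝ) * Real.log r⌋ := ⟨r, hr, rfl⟩
    have hcv : c ⌊(n : ℝ) * Real.log r⌋ = g h.choose := dif_pos h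
    obtain ⟨hs, hse⟩ := h.choose_spec
    rw [hcv]
    refine Real.le_sqrt_of_sq_le ((hGd r hr _ hs).trans ?_)
    have h2 := Int.abs_sub_lt_one_of_floor_eq_floor hse
    rw [← mul_sub, abs_mul, abs_of_pos hn', abs_sub_comm, ← lt_div_iff₀' hn'] at h2
    calc K * |Real.log r - Real.log h.choose| * b ^ 2 ≤ K * (1 / n) * 1 := by gcongr
      _ = K / n := by ring
  refine ⟨c, fun k hk => ?_, ?_⟩
  · by_cases h : ∃ r ∈ G, ⌊(n : ℝ) * Real.log r⌋ = k
    · have hcv : c k = g h.choose := dif_pos h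
      obtain ⟨hs, hse⟩ := h.choose_spec
      rw [hcv]
      refine Real.le_sqrt_of_sq_le ((hGb _ hs).trans ?_)
      have h3 : |Real.log h.choose| ≤ M := by
        rw [Finset.mem_Ico] at hk
        rw [← hse, Int.le_floor, Int.floor_lt] at hk
        push_cast at hk
        rw [abs_le]
        constructor
        · by_contra! hlt
          nlinarith [hk.1]
        · by_contra! hlt
          nlinarith [hk.2]
      calc K * (1 + |Real.log h.choose|) * b ^ 2 ≤ K * (1 + M) * 1 := by gcongr
        _ = _ := by ring
    · have hcv : c k = 0 := dif_neg h
      rw [hcv, norm_zero]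
      positivity
  · have h2 := lintegral_annulus_le (N := N) (M := M) (q := q) (τ := τ) (c := √(K / n))
      (h := fun x => v x - (annulus N M).indicator (fun x => c (logCell n x)) x)
      (by linarith) (by
        filter_upwards [hGv] with x hx hxM
        rw [Set.indicator_of_mem hxM, hx.2]
        exact hc _ hx.1)
    have h3 : ∫⁻ x in (annulus N M)ᶜ, ENNReal.ofReal
        (‖v x - (annulus N M).indicator (fun x => c (logCell n x)) x‖ ^ q * ‖x‖ ^ τ) =
        ∫⁻ x in (annulus N M)ᶜ, ENNReal.ofReal (‖v x‖ ^ q * ‖x‖ ^ τ) := by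
      refine setLIntegral_congr_fun (measurableSet_annulus N M).compl fun x hx => ?_
      rw [Set.indicator_of_notMem hx, sub_zero]
    rw [← ENNReal.ofReal_toReal hW.ne, ← ENNReal.ofReal_mul (by positivity)] at h2
    rw [← lintegral_add_compl _ (measurableSet_annulus N M), h3]
    refine (add_le_add h2 h1).trans ?_
    rw [← ENNReal.ofReal_add (by positivity) (by positivity)]
    refine ENNReal.ofReal_le_ofReal ?_
    have : η / 2 * b ^ q ≤ η / 2 := mul_le_of_le_one_right (by positivity) hbq
    linarith

/-- A finite `ε/2`-net of `T` is an `ε`-net of `S` once `S` is `ε/2`-close to `T`; the compact set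
may vary with `ε`. -/
theorem totallyBounded_of_forall_exists_isCompact {X : Type*} [PseudoMetricSpace X] {S : Set X}
    (h : ∀ ε > 0, ∃ T : Set X, IsCompact T ∧ ∀ s ∈ S, ∃ t ∈ T, dist s t ≤ ε) :
    TotallyBounded S := by
  rw [Metric.totallyBounded_iff]
  intro ε hε
  obtain ⟨T, hT, hST⟩ := h (ε / 2) (half_pos hε)
  obtain ⟨F, hF, hTF⟩ := Metric.totallyBounded_iff.1 hT.totallyBounded (ε / 2) (half_pos hε)
  refine ⟨F, hF, fun s hs => ?_⟩
  obtain ⟨t, ht, hst⟩ := hST s hs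
  have := hTF ht
  simp only [Set.mem_iUnion, Metric.mem_ball] at this ⊢
  obtain ⟨y, hy, hty⟩ := this
  exact ⟨y, hy, by linarith [dist_triangle s t y]⟩

/-! ### Closability of the weighted gradient -/

theorem lintegral_enorm_sq_Lp {α F : Type*} [MeasurableSpace α] [NormedAddCommGroup F]
    {m : Measure α} (f : Lp F 2 m) : ∫⁻ x, ‖f x‖ₑ ^ 2 ∂m = ‖f‖ₑ ^ 2 := by
  have h := eLpNorm_nnreal_pow_eq_lintegral (f := f) (μ := m) (p := 2) two_ne_zero
  rw [Lp.enorm_def, ← ENNReal.rpow_natCast]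
  simp only [← ENNReal.rpow_natCast]
  exact h.symm

/-- Cauchy–Schwarz with `1 = |x|^{d/2} |x|^{-d/2}`. As `|x|^{N-2}` is locally bounded, weighted `L²`
control gives local `L¹` control, origin included. -/
theorem sq_lintegral_mul_enorm_le {N : ℕ} (hN : 3 ≤ N) {F : Type*} [NormedAddCommGroup F]
    [MeasurableSpace F] [BorelSpace F] {f : EuclideanSpace ℝ (Fin N) → F} (hf : AEMeasurable f)
    (R : ℝ) :
    (∫⁻ x in Metric.ball 0 R, ‖f x‖ₑ) ^ 2 ≤
      (∫⁻ x in Metric.ball (0 : EuclideanSpace ℝ (Fin N)) R,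
        ENNReal.ofReal (‖x‖ ^ ((N : ℝ) - 2))) * ∫⁻ x, ‖f x‖ₑ ^ 2 ∂(hardyMeasure N) := by
  have : Nonempty (Fin N) := ⟨⟨0, by omega⟩⟩
  set d : ℝ := (N : ℝ) - 2 with hd
  have h0 : ∀ᵐ x : EuclideanSpace ℝ (Fin N), x ≠ 0 := by
    simp [ae_iff]
  have hpos {x : EuclideanSpace ℝ (Fin N)} (hx : x ≠ 0) : 0 < ‖x‖ := norm_pos_iff.2 hx
  have h1 : ∫⁻ x in Metric.ball 0 R, ‖f x‖ₑ = ∫⁻ x in Metric.ball 0 R,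
      ENNReal.ofReal (‖x‖ ^ (d / 2)) * (ENNReal.ofReal (‖x‖ ^ (-d / 2)) * ‖f x‖ₑ) := by
    refine lintegral_congr_ae (ae_restrict_of_ae ?_)
    filter_upwards [h0] with x hx
    rw [← mul_assoc, ← ENNReal.ofReal_mul (by positivity), ← Real.rpow_add (hpos hx)]
    ring_nf
    simp
  have hm1 : Measurable fun x : EuclideanSpace ℝ (Fin N) => ENNReal.ofReal (‖x‖ ^ (d / 2)) := by
    fun_prop
  have hm2 : AEMeasurable fun x : EuclideanSpace ℝ (Fin N) =>
      ENNReal.ofReal (‖x‖ ^ (-d / 2)) * ‖f x‖ₑ :=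
    (measurable_norm_rpow _).aemeasurable.mul hf.enorm
  rw [h1]
  refine (sq_lintegral_mul_le _ hm1.aemeasurable hm2.restrict).trans ?_
  rw [lintegral_powerMeasure _ (hf.enorm.pow_const 2)]
  refine mul_le_mul' (le_of_eq ?_) ((lintegral_mono' Measure.restrict_le_self le_rfl).trans
    (le_of_eq ?_))
  · refine lintegral_congr_ae (ae_restrict_of_ae ?_)
    filter_upwards [h0] with x hx
    rw [← ENNReal.ofReal_pow (by positivity), ← Real.rpow_natCast, ← Real.rpow_mul (norm_nonneg _)]
    congr 2
    push_cast; ring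
  · refine lintegral_congr_ae ?_
    filter_upwards [h0] with x hx
    rw [mul_pow, ← ENNReal.ofReal_pow (by positivity), ← Real.rpow_natCast,
      ← Real.rpow_mul (norm_nonneg _)]
    congr 3
    push_cast; ring

theorem lintegral_ball_norm_rpow_ne_top {N : ℕ} {d : ℝ} (hd : 0 ≤ d) (R : ℝ) :
    ∫⁻ x in Metric.ball (0 : EuclideanSpace ℝ (Fin N)) R, ENNReal.ofReal (‖x‖ ^ d) ≠ ⊤ := by
  refine ((setLIntegral_mono (g := fun _ => ENNReal.ofReal (R ^ d)) measurable_const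
    fun x hx => ENNReal.ofReal_le_ofReal ?_).trans_lt ?_).ne
  · have : ‖x‖ < R := by simpa using hx
    gcongr
  · rw [setLIntegral_const]
    exact ENNReal.mul_lt_top ENNReal.ofReal_lt_top measure_ball_lt_top

theorem locallyIntegrable_of_lintegral_hardyMeasure {N : ℕ} (hN : 3 ≤ N)
    {f : EuclideanSpace ℝ (Fin N) → ℂ} (hf : AEMeasurable f)
    (hfi : ∫⁻ x, ‖f x‖ₑ ^ 2 ∂(hardyMeasure N) ≠ ⊤) : LocallyIntegrable f := by
  have hN3 : (3 : ℝ) ≤ N := by exact_mod_cast hN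
  rw [locallyIntegrable_iff]
  intro k hk
  obtain ⟨R, hR⟩ := hk.isBounded.subset_ball 0
  refine IntegrableOn.mono_set ?_ hR
  refine ⟨hf.aestronglyMeasurable.restrict, ?_⟩
  have h := (sq_lintegral_mul_enorm_le hN hf R).trans_lt
    (ENNReal.mul_lt_top (lintegral_ball_norm_rpow_ne_top (by linarith) R).lt_top hfi.lt_top)
  rw [HasFiniteIntegral]
  by_contra htop
  rw [not_lt, top_le_iff] at htop
  simp [htop] at h

theorem tendsto_integral_smul_zero {N : ℕ} (hN : 3 ≤ N)
    {f : ℕ → EuclideanSpace ℝ (Fin N) → ℂ} (hf : ∀ n, AEMeasurable (f n))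
    (hlim : Tendsto (fun n => ∫⁻ x, ‖f n x‖ₑ ^ 2 ∂(hardyMeasure N)) atTop (𝓝 0))
    {h : EuclideanSpace ℝ (Fin N) → ℝ} (hc : Continuous h) (hs : HasCompactSupport h) :
    Tendsto (fun n => ∫ x, h x • f n x) atTop (𝓝 0) := by
  have hN3 : (3 : ℝ) ≤ N := by exact_mod_cast hN
  obtain ⟨C, hC⟩ := hc.bounded_above_of_compact_support hs
  obtain ⟨R, hR⟩ := hs.isCompact.isBounded.subset_ball (0 : EuclideanSpace ℝ (Fin N))
  set I := ∫⁻ x in Metric.ball (0 : EuclideanSpace ℝ (Fin N)) R,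
    ENNReal.ofReal (‖x‖ ^ ((N : ℝ) - 2)) with hI
  have hIt : I ≠ ⊤ := lintegral_ball_norm_rpow_ne_top (by linarith) R
  have hbd : ∀ n, ‖∫ x, h x • f n x‖ₑ ^ 2 ≤
      ENNReal.ofReal C ^ 2 * I * ∫⁻ x, ‖f n x‖ₑ ^ 2 ∂(hardyMeasure N) := by
    intro n
    have h1 : ‖∫ x, h x • f n x‖ₑ ≤ ENNReal.ofReal C * ∫⁻ x in Metric.ball 0 R, ‖f n x‖ₑ := by
      refine (enorm_integral_le_lintegral_enorm _).trans ?_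
      rw [← lintegral_const_mul' _ _ ENNReal.ofReal_ne_top,
        ← lintegral_indicator Metric.isOpen_ball.measurableSet]
      refine lintegral_mono fun x => ?_
      by_cases hx : x ∈ Metric.ball 0 R
      · rw [Set.indicator_of_mem hx, enorm_smul]
        gcongr
        rw [← ofReal_norm]
        exact ENNReal.ofReal_le_ofReal (hC x)
      · have : h x = 0 := image_eq_zero_of_notMem_tsupport fun hx' => hx (hR hx')
        simp [this]
    refine (pow_le_pow_left' h1 2).trans ?_
    rw [mul_pow, mul_assoc]
    gcongr
    exact sq_lintegral_mul_enorm_le hN (hf n) R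
  have h2 : Tendsto (fun n => ‖∫ x, h x • f n x‖ₑ ^ 2) atTop (𝓝 0) := by
    have h3 := ENNReal.Tendsto.const_mul (a := ENNReal.ofReal C ^ 2 * I) hlim
      (Or.inr (ENNReal.mul_ne_top (by simp) hIt))
    rw [mul_zero] at h3
    exact tendsto_of_tendsto_of_tendsto_of_le_of_le tendsto_const_nhds h3 (fun _ => zero_le)
      hbd
  have h4 : Tendsto (fun n => (‖∫ x, h x • f n x‖ₑ ^ 2) ^ (1 / 2 : ℝ)) atTop (𝓝 0) := by
    have := (ENNReal.continuous_rpow_const (y := 1 / 2)).tendsto 0 |>.comp h2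
    simpa [ENNReal.zero_rpow_of_pos, Function.comp_def] using this
  rw [tendsto_zero_iff_enorm_tendsto_zero]
  refine h4.congr fun n => ?_
  rw [← ENNReal.rpow_natCast, ← ENNReal.rpow_mul]
  simp

theorem integral_smul_fderiv_eq_neg {N : ℕ} {φ : EuclideanSpace ℝ (Fin N) → ℂ} (hφ : IsTest φ)
    {ψ : EuclideanSpace ℝ (Fin N) → ℝ} (hψ : ContDiff ℝ (⊤ : ℕ∞) ψ) (hs : HasCompactSupport ψ)
    (e : EuclideanSpace ℝ (Fin N)) :
    ∫ x, ψ x • fderiv ℝ φ x e = -∫ x, fderiv ℝ ψ x e • φ x := by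
  have h1 : Continuous fun x => fderiv ℝ φ x e :=
    (hφ.1.continuous_fderiv (by simp)).clm_apply continuous_const
  have h2 : Continuous fun x => fderiv ℝ ψ x e :=
    (hψ.continuous_fderiv (by simp)).clm_apply continuous_const
  refine integral_bilinear_fderiv_right_eq_neg_left_of_integrable
    (B := ContinuousLinearMap.lsmul ℝ ℝ) ?_ ?_ ?_
    (fun x _ => hψ.differentiable (by simp) x) (fun x _ => hφ.1.differentiable (by simp) x)
  · exact (h2.smul hφ.1.continuous).integrable_of_hasCompactSupport hφ.2.smul_left
  · exact (hψ.continuous.smul h1).integrable_of_hasCompactSupport hs.smul_right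
  · exact (hψ.continuous.smul hφ.1.continuous).integrable_of_hasCompactSupport hs.smul_right

/-- The gradient is closable: if test functions tend to zero in `L²(|x|^{-(N-2)} dx)`, then so does
any limit of their gradients. -/
theorem gradient_limit_eq_zero {N : ℕ} (hN : 3 ≤ N)
    {φ : ℕ → EuclideanSpace ℝ (Fin N) → ℂ} (hφ : ∀ n, IsTest (φ n))
    (hlim : Tendsto (fun n => ∫⁻ x, ‖φ n x‖ₑ ^ 2 ∂(hardyMeasure N)) atTop (𝓝 0))
    {w : ℕ → Lp (EuclideanSpace ℂ (Fin N)) 2 (hardyMeasure N)}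
    (hw : ∀ n, w n =ᵐ[hardyMeasure N] cgrad (φ n))
    {W : Lp (EuclideanSpace ℂ (Fin N)) 2 (hardyMeasure N)} (hW : Tendsto w atTop (𝓝 W)) :
    W = 0 := by
  have hac := volume_absolutelyContinuous_powerMeasure hN (-((N : ℝ) - 2))
  have hWm : AEStronglyMeasurable W (volume : Measure (EuclideanSpace ℝ (Fin N))) :=
    (Lp.aestronglyMeasurable W).mono_ac hac
  have hcomp : ∀ i : Fin N, ∀ᵐ x, W x i = 0 := by
    intro i
    have hWi : AEMeasurable fun x => W x i :=
      ((by fun_prop : Continuous fun z : EuclideanSpace ℂ (Fin N) =>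
        z i).comp_aestronglyMeasurable hWm).aemeasurable
    have hle : ∀ z : EuclideanSpace ℂ (Fin N), ‖z i‖ₑ ≤ ‖z‖ₑ := fun z => by
      rw [enorm_le_iff_norm_le]; exact PiLp.norm_apply_le z i
    have hWfin : ∫⁻ x, ‖W x i‖ₑ ^ 2 ∂(hardyMeasure N) ≠ ⊤ := by
      refine ((lintegral_mono fun x => pow_le_pow_left' (hle (W x)) 2).trans_lt ?_).ne
      rw [lintegral_enorm_sq_Lp]
      simp
    have hWloc := locallyIntegrable_of_lintegral_hardyMeasure hN hWi hWfin
    -- Tested against `ψ`, the component splits as `∫ ψ W_i = ∫ ψ (W_i - ∂_i φ_n) - ∫ ∂_i ψ φ_n`, by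
    -- integration by parts; both terms tend to zero.
    refine ae_eq_zero_of_integral_contDiff_smul_eq_zero hWloc fun ψ hψ hψs => ?_
    set e : EuclideanSpace ℝ (Fin N) := EuclideanSpace.single i (1 : ℝ) with he
    have hcφ : ∀ n, Continuous fun x => fderiv ℝ (φ n) x e := fun n =>
      ((hφ n).1.continuous_fderiv (by simp)).clm_apply continuous_const
    have hcψ : Continuous fun x => fderiv ℝ ψ x e :=
      (hψ.continuous_fderiv (by simp)).clm_apply continuous_const
    have hsψ : HasCompactSupport fun x => fderiv ℝ ψ x e := hψs.fderiv_apply ℝ e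
    have h1 := tendsto_integral_smul_zero hN
      (fun n => (hφ n).1.continuous.measurable.aemeasurable) hlim hcψ hsψ
    have h2 : Tendsto (fun n => ∫ x, ψ x • (W x i - fderiv ℝ (φ n) x e)) atTop (𝓝 0) := by
      refine tendsto_integral_smul_zero hN
        (fun n => hWi.sub (hcφ n).measurable.aemeasurable) ?_ hψ.continuous hψs
      have h3 : Tendsto (fun n => ‖W - w n‖ₑ ^ 2) atTop (𝓝 0) := by
        have h4 : Tendsto (fun n => W - w n) atTop (𝓝 0) := by
          simpa using (tendsto_const_nhds (x := W)).sub hW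
        have h5 := (tendsto_zero_iff_enorm_tendsto_zero.1 h4)
        simpa [Function.comp_def] using (ENNReal.continuous_pow 2).tendsto 0 |>.comp h5
      refine tendsto_of_tendsto_of_tendsto_of_le_of_le tendsto_const_nhds h3
        (fun _ => zero_le) fun n => ?_
      rw [← lintegral_enorm_sq_Lp]
      refine lintegral_mono_ae ?_
      filter_upwards [hw n, Lp.coeFn_sub W (w n)] with x h6 h7
      rw [h7, Pi.sub_apply (f := (W : EuclideanSpace ℝ (Fin N) → EuclideanSpace ℂ (Fin N))), h6]
      exact pow_le_pow_left' (hle (W x - cgrad (φ n) x)) 2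
    have h3 : ∀ n, ∫ x, ψ x • W x i =
        (∫ x, ψ x • (W x i - fderiv ℝ (φ n) x e)) - ∫ x, fderiv ℝ ψ x e • φ n x := by
      intro n
      have hi1 : Integrable fun x => ψ x • W x i :=
        hWloc.integrable_smul_left_of_hasCompactSupport hψ.continuous hψs
      have hi2 : Integrable fun x => ψ x • fderiv ℝ (φ n) x e :=
        (hψ.continuous.smul (hcφ n)).integrable_of_hasCompactSupport hψs.smul_right
      simp only [smul_sub]
      rw [integral_sub hi1 hi2, integral_smul_fderiv_eq_neg (hφ n) hψ hψs]
      ring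
    have h4 := h2.sub h1
    simp only [← h3, sub_zero] at h4
    exact tendsto_nhds_unique tendsto_const_nhds h4
  have hz : ∀ᵐ x, W x = 0 := by
    filter_upwards [ae_all_iff.2 hcomp] with x hx
    ext i
    simpa using hx i
  refine Lp.ext ?_
  filter_upwards [(powerMeasure_absolutelyContinuous_volume _).ae_le hz,
    Lp.coeFn_zero (EuclideanSpace ℂ (Fin N)) 2 (hardyMeasure N)] with x h1 h2
  rw [h1, h2, Pi.zero_apply]

/-! ### Multiplication by powers of the radius -/

/-- Multiplication by `|x|^β`. -/
def powMul {N : ℕ} (β : ℝ) (f : EuclideanSpace ℝ (Fin N) → ℂ) (x : EuclideanSpace ℝ (Fin N)) : ℂ :=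
  ((‖x‖ ^ β : ℝ) : ℂ) * f x

theorem norm_powMul {N : ℕ} (β : ℝ) (f : EuclideanSpace ℝ (Fin N) → ℂ)
    (x : EuclideanSpace ℝ (Fin N)) : ‖powMul β f x‖ = ‖x‖ ^ β * ‖f x‖ := by
  rw [powMul, norm_mul, Complex.norm_real, Real.norm_of_nonneg (by positivity)]

theorem powMul_powMul_neg {N : ℕ} (β : ℝ) (f : EuclideanSpace ℝ (Fin N) → ℂ)
    {x : EuclideanSpace ℝ (Fin N)} (hx : x ≠ 0) : powMul β (powMul (-β) f) x = f x := by
  have h : 0 < ‖x‖ := norm_pos_iff.mpr hx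
  rw [powMul, powMul, ← mul_assoc, ← Complex.ofReal_mul, ← Real.rpow_add h]
  simp

theorem aemeasurable_powMul {N : ℕ} (β : ℝ) {f : EuclideanSpace ℝ (Fin N) → ℂ}
    (hf : AEMeasurable f) : AEMeasurable (powMul β f) := by
  have : Measurable fun x : EuclideanSpace ℝ (Fin N) => ((‖x‖ ^ β : ℝ) : ℂ) :=
    Complex.measurable_ofReal.comp (measurable_norm.pow_const β)
  exact this.aemeasurable.mul hf

theorem ae_volume_ne_zero {N : ℕ} (hN : 3 ≤ N) :
    ∀ᵐ x : EuclideanSpace ℝ (Fin N), x ≠ 0 := by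
  have : Nonempty (Fin N) := ⟨⟨0, by omega⟩⟩
  simp [ae_iff]

/-- The exponent `2β - (N-2)` makes `f ↦ |x|^β f` preserve the `L²` norm. -/
theorem lintegral_powMul_sq {N : ℕ} (hN : 3 ≤ N) (β : ℝ) {f : EuclideanSpace ℝ (Fin N) → ℂ}
    (hf : AEMeasurable f) :
    ∫⁻ x, ‖powMul β f x‖ₑ ^ 2 ∂(hardyMeasure N) =
      ∫⁻ x, ‖f x‖ₑ ^ 2 ∂(powerMeasure N (2 * β - ((N : ℝ) - 2))) := by
  rw [lintegral_powerMeasure _ (hf.enorm.pow_const 2),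
    lintegral_powerMeasure _ ((aemeasurable_powMul β hf).enorm.pow_const 2)]
  refine lintegral_congr_ae ?_
  filter_upwards [ae_volume_ne_zero hN] with x hx
  have h0 : 0 < ‖x‖ := norm_pos_iff.2 hx
  rw [← ofReal_norm, ← ofReal_norm, norm_powMul, ← ENNReal.ofReal_pow (by positivity),
    ← ENNReal.ofReal_pow (by positivity), ← ENNReal.ofReal_mul (by positivity),
    ← ENNReal.ofReal_mul (by positivity), mul_pow, ← mul_assoc, ← Real.rpow_natCast (‖x‖ ^ β),
    ← Real.rpow_mul h0.le, ← Real.rpow_add h0]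
  congr 3
  push_cast; ring

theorem lintegral_rpow_powerMeasure {N : ℕ} (hN : 3 ≤ N) (β τ : ℝ) {q : ℝ} (hq : 0 ≤ q)
    {f : EuclideanSpace ℝ (Fin N) → ℂ} (hf : AEMeasurable f) :
    ∫⁻ x, ‖f x‖ₑ ^ q ∂(powerMeasure N (β * q + τ)) =
      ∫⁻ x, ENNReal.ofReal (‖powMul β f x‖ ^ q * ‖x‖ ^ τ) := by
  rw [lintegral_powerMeasure _ (hf.enorm.pow_const q)]
  refine lintegral_congr_ae ?_
  filter_upwards [ae_volume_ne_zero hN] with x hx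
  have h0 : 0 < ‖x‖ := norm_pos_iff.2 hx
  rw [← ofReal_norm, norm_powMul, ENNReal.ofReal_rpow_of_nonneg (norm_nonneg _) hq,
    ← ENNReal.ofReal_mul (by positivity), Real.mul_rpow (by positivity) (norm_nonneg _),
    ← Real.rpow_mul h0.le, Real.rpow_add h0]
  congr 1
  ring

theorem eLpNorm_le_of_lintegral_le {N : ℕ} (hN : 3 ≤ N) (β τ : ℝ) {q : ℝ} (hq : 0 < q)
    {f : EuclideanSpace ℝ (Fin N) → ℂ} (hf : AEMeasurable f) {A : ℝ} (hA : 0 ≤ A)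
    (h : ∫⁻ x, ENNReal.ofReal (‖powMul β f x‖ ^ q * ‖x‖ ^ τ) ≤ ENNReal.ofReal (A ^ q)) :
    eLpNorm f (ENNReal.ofReal q) (powerMeasure N (β * q + τ)) ≤ ENNReal.ofReal A := by
  rw [eLpNorm_eq_lintegral_rpow_enorm_toReal (by simpa using hq) ENNReal.ofReal_ne_top,
    ENNReal.toReal_ofReal hq.le, lintegral_rpow_powerMeasure hN β τ hq.le hf]
  rw [← ENNReal.ofReal_rpow_of_nonneg hA hq.le] at h
  refine (ENNReal.rpow_le_rpow h (by positivity)).trans ?_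
  rw [← ENNReal.rpow_mul, mul_one_div_cancel hq.ne', ENNReal.rpow_one]

/-! ### Limits of test pairs -/

/-- The pair `p` is a limit of the pairs `(|x|^{-β} φ, ∇φ)` with test functions `φ`. -/
def IsTestLimit {N : ℕ} {m : Measure (EuclideanSpace ℝ (Fin N))} (β : ℝ) (p : PairSpace N m) :
    Prop :=
  ∃ (P : ℕ → PairSpace N m) (φ : ℕ → EuclideanSpace ℝ (Fin N) → ℂ), Tendsto P atTop (𝓝 p) ∧
    ∀ n, IsTest (φ n) ∧ (P n).fst =ᵐ[volume] powMul (-β) (φ n) ∧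
      (P n).snd =ᵐ[hardyMeasure N] cgrad (φ n)

section Pairs

variable {N : ℕ} {β : ℝ} {p : PairSpace N (powerMeasure N (2 * β - ((N : ℝ) - 2)))}

theorem aemeasurable_fst (hN : 3 ≤ N) : AEMeasurable p.fst :=
  ((Lp.aestronglyMeasurable p.fst).mono_ac
    (volume_absolutelyContinuous_powerMeasure hN _)).aemeasurable

theorem lintegral_powMul_fst (hN : 3 ≤ N) :
    ∫⁻ x, ‖powMul β p.fst x‖ₑ ^ 2 ∂(hardyMeasure N) = ‖p.fst‖ₑ ^ 2 := by
  rw [lintegral_powMul_sq hN β (aemeasurable_fst hN), lintegral_enorm_sq_Lp]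

theorem enorm_fst_sq_le : ‖p.fst‖ₑ ^ 2 ≤ ENNReal.ofReal (‖p‖ ^ 2) := by
  rw [← ofReal_norm, ← ENNReal.ofReal_pow (norm_nonneg _)]
  refine ENNReal.ofReal_le_ofReal ?_
  rw [WithLp.prod_norm_sq_eq_of_L2]
  exact le_add_of_nonneg_right (sq_nonneg _)

theorem enorm_snd_sq_le : ‖p.snd‖ₑ ^ 2 ≤ ENNReal.ofReal (‖p‖ ^ 2) := by
  rw [← ofReal_norm, ← ENNReal.ofReal_pow (norm_nonneg _)]
  refine ENNReal.ofReal_le_ofReal ?_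
  rw [WithLp.prod_norm_sq_eq_of_L2]
  exact le_add_of_nonneg_left (sq_nonneg _)

theorem tendsto_fst_of_tendsto {m : Measure (EuclideanSpace ℝ (Fin N))}
    {P : ℕ → PairSpace N m} {p : PairSpace N m}
    (hP : Tendsto P atTop (𝓝 p)) : Tendsto (fun n => (P n).fst) atTop (𝓝 p.fst) :=
  (WithLp.continuous_fst ..).tendsto p |>.comp hP

theorem tendsto_snd_of_tendsto {m : Measure (EuclideanSpace ℝ (Fin N))}
    {P : ℕ → PairSpace N m} {p : PairSpace N m}
    (hP : Tendsto P atTop (𝓝 p)) : Tendsto (fun n => (P n).snd) atTop (𝓝 p.snd) :=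
  (WithLp.continuous_snd ..).tendsto p |>.comp hP

theorem exists_hasLogProfile_of_isTestLimit (hN : 3 ≤ N) (β : ℝ) :
    ∃ K : ℝ, 0 < K ∧ ∀ p : PairSpace N (powerMeasure N (2 * β - ((N : ℝ) - 2))),
      IsTestLimit β p → IsRadial (powerMeasure N (2 * β - ((N : ℝ) - 2))) p.fst →
      HasLogProfile K ‖p‖ (powMul β p.fst) := by
  obtain ⟨K, hK, H⟩ := exists_hasLogProfile hN
  refine ⟨K, hK, fun p hp hr => ?_⟩
  obtain ⟨P, φ, hP, hPφ⟩ := hp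
  obtain ⟨g, hg⟩ := hr
  have hac := volume_absolutelyContinuous_powerMeasure hN (2 * β - ((N : ℝ) - 2))
  -- Norm convergence of the first components gives almost everywhere convergence along a
  -- subsequence; the energies converge along it to `‖p.snd‖²`.
  obtain ⟨ns, hns, hae⟩ :=
    (tendstoInMeasure_of_tendsto_Lp (tendsto_fst_of_tendsto hP)).exists_seq_tendsto_ae
  refine H ‖p‖ _ (fun n => φ (ns n)) (fun r => ((r ^ β : ℝ) : ℂ) * g r) (‖p.snd‖ₑ ^ 2)
    (norm_nonneg _) (aemeasurable_powMul β (aemeasurable_fst hN)) (fun n => (hPφ _).1)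
    ?_ ?_ ?_ enorm_snd_sq_le ((lintegral_powMul_fst hN).trans_le enorm_fst_sq_le)
  · filter_upwards [hac.ae_le hg] with x hx
    rw [powMul, hx]
  · filter_upwards [hac.ae_le hae, ae_all_iff.2 fun n => (hPφ n).2.1, ae_volume_ne_zero hN]
      with x h1 h2 h3
    refine (h1.const_mul (((‖x‖ ^ β : ℝ) : ℂ))).congr fun n => ?_
    rw [h2, ← powMul_powMul_neg β (φ (ns n)) h3]
    rfl
  · have h1 : ∀ n, ∫⁻ x, ‖cgrad (φ (ns n)) x‖ₑ ^ 2 ∂(hardyMeasure N) = ‖(P (ns n)).snd‖ₑ ^ 2 := by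
      intro n
      rw [← lintegral_enorm_sq_Lp]
      refine lintegral_congr_ae ?_
      filter_upwards [(hPφ (ns n)).2.2] with x hx
      rw [hx]
    simp only [h1]
    exact ((ENNReal.continuous_pow 2).tendsto _).comp
      ((tendsto_snd_of_tendsto hP).comp hns.tendsto_atTop).enorm

/-- The inclusion forgets the gradient component, which closability forces to vanish with the
function. -/
theorem eq_zero_of_fst_eq_zero (hN : 3 ≤ N) (hp : IsTestLimit β p)
    (h0 : p.fst = 0) : p = 0 := by
  obtain ⟨P, φ, hP, hPφ⟩ := hp
  have h1 : p.snd = 0 := by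
    refine gradient_limit_eq_zero hN (fun n => (hPφ n).1) ?_ (fun n => (hPφ n).2.2)
      (tendsto_snd_of_tendsto hP)
    have h2 : ∀ n, ∫⁻ x, ‖φ n x‖ₑ ^ 2 ∂(hardyMeasure N) = ‖(P n).fst‖ₑ ^ 2 := by
      intro n
      rw [← lintegral_powMul_fst hN]
      refine lintegral_congr_ae ((powerMeasure_absolutelyContinuous_volume _).ae_le ?_)
      filter_upwards [(hPφ n).2.1, ae_volume_ne_zero hN] with x h3 h4
      rw [powMul, h3, ← powMul, powMul_powMul_neg β _ h4]
    simp only [h2]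
    have h3 := (tendsto_fst_of_tendsto hP).enorm
    rw [h0, enorm_zero] at h3
    simpa [Function.comp_def] using ((ENNReal.continuous_pow 2).tendsto 0).comp h3
  exact WithLp.ofLp_injective 2 (Prod.ext h0 h1)

end Pairs

/-! ### Boundedness, compactness and the inclusion operator -/

theorem coeFn_sum_smul_Lp {α ι : Type*} [MeasurableSpace α] {ν : Measure α} {r : ENNReal}
    (s : Finset ι) (c : ι → ℂ) (F : ι → Lp ℂ r ν) :
    (∑ k ∈ s, c k • F k : Lp ℂ r ν) =ᵐ[ν] fun x => ∑ k ∈ s, c k * F k x := by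
  classical
  induction s using Finset.induction_on with
  | empty =>
    simp only [Finset.sum_empty]
    exact Lp.coeFn_zero ℂ r ν
  | insert k s hk ih =>
    rw [Finset.sum_insert hk]
    filter_upwards [Lp.coeFn_add (c k • F k) (∑ k ∈ s, c k • F k), Lp.coeFn_smul (c k) (F k), ih]
      with x h1 h2 h3
    rw [h1, Pi.add_apply, h2, h3, Finset.sum_insert hk]
    rfl

/-- The indicator of a logarithmic cell in an annulus, multiplied by `|x|^{-β}`. -/
def cellFun (N M n : ℕ) (β : ℝ) (k : ℤ) : EuclideanSpace ℝ (Fin N) → ℂ :=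
  powMul (-β) ((annulus N M ∩ logCell n ⁻¹' {k}).indicator fun _ => 1)

theorem measurable_cellFun (N M n : ℕ) (β : ℝ) (k : ℤ) : Measurable (cellFun N M n β k) := by
  have h1 : Measurable fun x : EuclideanSpace ℝ (Fin N) => ((‖x‖ ^ (-β) : ℝ) : ℂ) :=
    Complex.measurable_ofReal.comp (measurable_norm.pow_const _)
  exact h1.mul (measurable_const.indicator ((measurableSet_annulus N M).inter
    (measurable_logCell n (measurableSet_singleton k))))

/-- Each point of the annulus lies in exactly one cell, so the step functions are combinations of
finitely many fixed vectors. -/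
theorem sum_mul_cellFun {N M n : ℕ} (hn : 0 < n) (β : ℝ) (c : ℤ → ℂ)
    (x : EuclideanSpace ℝ (Fin N)) :
    ∑ k ∈ Finset.Ico (-(n * M : ℤ)) (n * M), c k * cellFun N M n β k x =
      powMul (-β) ((annulus N M).indicator fun x => c (logCell n x)) x := by
  simp only [cellFun, powMul]
  by_cases hx : x ∈ annulus N M
  · have hx' : x ∈ annulus N M ∩ logCell n ⁻¹' {logCell n x} := ⟨hx, rfl⟩
    rw [Finset.sum_eq_single_of_mem (logCell n x) (logCell_mem_Ico hn hx)]
    · rw [Set.indicator_of_mem hx, Set.indicator_of_mem hx']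
      ring
    · intro k _ hk
      rw [Set.indicator_of_notMem (fun h => hk h.2.symm)]
      ring
  · rw [Set.indicator_of_notMem hx]
    refine (Finset.sum_eq_zero fun k _ => ?_).trans (mul_zero _).symm
    rw [Set.indicator_of_notMem (fun h => hx h.1)]
    ring

theorem memLp_cellFun {N : ℕ} (hN : 3 ≤ N) (M n : ℕ) (β τ : ℝ) {q : ℝ} (hq : 0 < q) (k : ℤ) :
    MemLp (cellFun N M n β k) (ENNReal.ofReal q) (powerMeasure N (β * q + τ)) := by
  refine ⟨(measurable_cellFun N M n β k).aestronglyMeasurable, ?_⟩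
  rw [eLpNorm_lt_top_iff_lintegral_rpow_enorm_lt_top (by simpa using hq) ENNReal.ofReal_ne_top,
    ENNReal.toReal_ofReal hq.le,
    lintegral_rpow_powerMeasure hN β τ hq.le (measurable_cellFun N M n β k).aemeasurable]
  refine lt_of_le_of_lt ?_ (lintegral_annulus_norm_rpow_lt_top N M τ)
  rw [← lintegral_indicator (measurableSet_annulus N M)]
  refine lintegral_mono_ae ?_
  filter_upwards [ae_volume_ne_zero hN] with x hx
  rw [cellFun, powMul_powMul_neg β _ hx]
  by_cases h : x ∈ annulus N M ∩ logCell n ⁻¹' {k}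
  · simp [Set.indicator_of_mem h, Set.indicator_of_mem h.1]
  · simp [Set.indicator_of_notMem h, hq.ne']

section Embedding

variable {N : ℕ} {β q : ℝ}

theorem exists_eLpNorm_fst_le (hN : 3 ≤ N) (hq : 2 < q) (hq' : q < 2 * (N : ℝ) / ((N : ℝ) - 2))
    (β : ℝ) :
    ∃ C : ℝ, 0 ≤ C ∧ ∀ p : PairSpace N (powerMeasure N (2 * β - ((N : ℝ) - 2))),
      IsTestLimit β p → IsRadial (powerMeasure N (2 * β - ((N : ℝ) - 2))) p.fst →
      eLpNorm p.fst (ENNReal.ofReal q) (powerMeasure N (β * q + -(((N : ℝ) - 2) / 2 * q))) ≤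
        ENNReal.ofReal (C * ‖p‖) := by
  obtain ⟨K, hK, H⟩ := exists_hasLogProfile_of_isTestLimit hN β
  obtain ⟨C, hC, HC⟩ := exists_lintegral_le_of_hasLogProfile hN hq hq' hK.le
  refine ⟨C ^ q⁻¹, by positivity, fun p hp hr => ?_⟩
  refine eLpNorm_le_of_lintegral_le hN β _ (by linarith) (aemeasurable_fst hN) (by positivity) ?_
  rw [Real.mul_rpow (by positivity) (norm_nonneg _), Real.rpow_inv_rpow hC (by linarith)]
  exact HC ‖p‖ _ (norm_nonneg _) (H p hp hr) (aemeasurable_powMul β (aemeasurable_fst hN))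
    ((lintegral_powMul_fst hN).trans_le enorm_fst_sq_le)

theorem exists_isCompact_eLpNorm_sub_le [Fact (1 ≤ ENNReal.ofReal q)] (hN : 3 ≤ N) (hq : 2 < q)
    (hq' : q < 2 * (N : ℝ) / ((N : ℝ) - 2)) (β : ℝ) {ε : ℝ} (hε : 0 < ε) :
    ∃ T : Set (Lp ℂ (ENNReal.ofReal q) (powerMeasure N (β * q + -(((N : ℝ) - 2) / 2 * q)))),
      IsCompact T ∧ ∀ p : PairSpace N (powerMeasure N (2 * β - ((N : ℝ) - 2))),
      IsTestLimit β p → IsRadial (powerMeasure N (2 * β - ((N : ℝ) - 2))) p.fst → ‖p‖ ≤ 1 →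
      ∃ t ∈ T, eLpNorm (fun x => p.fst x - t x) (ENNReal.ofReal q)
        (powerMeasure N (β * q + -(((N : ℝ) - 2) / 2 * q))) ≤ ENNReal.ofReal ε := by
  have hq0 : 0 < q := by linarith
  obtain ⟨K, hK, H⟩ := exists_hasLogProfile_of_isTestLimit hN β
  obtain ⟨M, n, hn, HS⟩ := exists_step_approx hN hq hq' hK.le (Real.rpow_pos_of_pos hε q)
  set ν := powerMeasure N (β * q + -(((N : ℝ) - 2) / 2 * q)) with hν
  set I := Finset.Ico (-(n * M : ℤ)) (n * M) with hI
  let F : ℤ → Lp ℂ (ENNReal.ofReal q) ν := fun k => (memLp_cellFun hN M n β _ hq0 k).toLp _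
  -- A continuous image of a product of closed discs. The product runs over all of `ℤ` and is
  -- compact by Tychonoff, but only indices in `I` enter the sum.
  refine ⟨(fun c : ℤ → ℂ => ∑ k ∈ I, c k • F k) ''
    Set.univ.pi fun _ => Metric.closedBall 0 √(K * (1 + M)), ?_, fun p hp hr hp1 => ?_⟩
  · refine (isCompact_univ_pi fun _ => isCompact_closedBall _ _).image ?_
    fun_prop
  · obtain ⟨c, hc, hcS⟩ := HS ‖p‖ _ (norm_nonneg _) hp1 (H p hp hr)
      (aemeasurable_powMul β (aemeasurable_fst hN))
      ((lintegral_powMul_fst hN).trans_le enorm_fst_sq_le)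
    -- The values of `c` are bounded only on `I`, so they are replaced by `0` elsewhere.
    refine ⟨∑ k ∈ I, c k • F k, ⟨fun k => if k ∈ I then c k else 0, fun k _ => ?_, ?_⟩, ?_⟩
    · by_cases hk : k ∈ I
      · simpa [hk] using hc k hk
      · simp [hk]
    · refine Finset.sum_congr rfl fun k hk => ?_
      simp only [hk, if_true]
    · set S : EuclideanSpace ℝ (Fin N) → ℂ :=
        (annulus N M).indicator fun x => c (logCell n x) with hS
      have hSm : Measurable S := ((measurable_from_top (f := c)).comp
        (measurable_logCell n)).indicator (measurableSet_annulus N M)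
      have hT : (∑ k ∈ I, c k • F k : Lp ℂ (ENNReal.ofReal q) ν) =ᵐ[ν] powMul (-β) S := by
        filter_upwards [coeFn_sum_smul_Lp I c F, ae_all_iff.2 fun k =>
          (memLp_cellFun hN M n β _ hq0 k).coeFn_toLp] with x h1 h2
        rw [h1, ← sum_mul_cellFun hn]
        exact Finset.sum_congr rfl fun k _ => by rw [h2 k]
      have hcongr : (fun x => p.fst x - (∑ k ∈ I, c k • F k : Lp ℂ (ENNReal.ofReal q) ν) x) =ᵐ[ν]
          fun x => p.fst x - powMul (-β) S x := by
        filter_upwards [hT] with x hx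
        rw [hx]
      rw [eLpNorm_congr_ae hcongr]
      refine eLpNorm_le_of_lintegral_le hN β _ hq0 ((aemeasurable_fst hN).sub
        (aemeasurable_powMul _ hSm.aemeasurable)) hε.le (le_trans (le_of_eq ?_) hcS)
      refine lintegral_congr_ae ?_
      filter_upwards [ae_volume_ne_zero hN] with x hx
      have : powMul β ((p.fst : EuclideanSpace ℝ (Fin N) → ℂ) - powMul (-β) S) x
          = powMul β p.fst x - S x := by
        rw [← powMul_powMul_neg β S hx]
        simp only [powMul, Pi.sub_apply]
        ring
      rw [this]

/-- Since `m`, `ν` and `volume` have the same null sets, one representative serves for all three.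
The image of the unit ball is totally bounded in a complete space, hence relatively compact. -/
theorem embedsCompactly_of_eLpNorm_le [Fact (1 ≤ ENNReal.ofReal q)]
    {m ν : Measure (EuclideanSpace ℝ (Fin N))} (hmv : m ≪ volume) (hvν : volume ≪ ν) (hνm : ν ≪ m)
    {V : Submodule ℂ (PairSpace N m)} {C : ℝ} (hC : 0 ≤ C)
    (hbd : ∀ p ∈ V, eLpNorm p.fst (ENNReal.ofReal q) ν ≤ ENNReal.ofReal (C * ‖p‖))
    (hinj : ∀ p ∈ V, p.fst = 0 → p = 0)
    (hcomp : ∀ ε > 0, ∃ T : Set (Lp ℂ (ENNReal.ofReal q) ν), IsCompact T ∧ ∀ p ∈ V, ‖p‖ ≤ 1 →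
      ∃ t ∈ T, eLpNorm (fun x => p.fst x - t x) (ENNReal.ofReal q) ν ≤ ENNReal.ofReal ε) :
    EmbedsCompactly V q ν := by
  have hmem : ∀ p : V, MemLp (p : PairSpace N m).fst (ENNReal.ofReal q) ν := fun p =>
    ⟨(Lp.aestronglyMeasurable _).mono_ac hνm, (hbd p p.2).trans_lt ENNReal.ofReal_lt_top⟩
  let J₀ : V →ₗ[ℂ] Lp ℂ (ENNReal.ofReal q) ν :=
    { toFun := fun p => (hmem p).toLp _
      map_add' := fun p p' => by
        refine Lp.ext ?_
        filter_upwards [(hmem (p + p')).coeFn_toLp, (hmem p).coeFn_toLp, (hmem p').coeFn_toLp,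
          Lp.coeFn_add ((hmem p).toLp _) ((hmem p').toLp _),
          hνm.ae_le (Lp.coeFn_add (p : PairSpace N m).fst (p' : PairSpace N m).fst)]
          with x h1 h2 h3 h4 h5
        rw [h1, h4, Pi.add_apply, h2, h3]
        exact h5
      map_smul' := fun c p => by
        refine Lp.ext ?_
        filter_upwards [(hmem (c • p)).coeFn_toLp, (hmem p).coeFn_toLp,
          Lp.coeFn_smul c ((hmem p).toLp _),
          hνm.ae_le (Lp.coeFn_smul c (p : PairSpace N m).fst)] with x h1 h2 h3 h4
        rw [h1, RingHom.id_apply, h3, Pi.smul_apply, h2]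
        exact h4 }
  have hJ₀ : ∀ p : V, J₀ p =ᵐ[ν] (p : PairSpace N m).fst := fun p => (hmem p).coeFn_toLp
  let J : V →L[ℂ] Lp ℂ (ENNReal.ofReal q) ν := J₀.mkContinuous C fun p => by
    have : ‖J₀ p‖ = (eLpNorm (p : PairSpace N m).fst (ENNReal.ofReal q) ν).toReal :=
      Lp.norm_toLp _ (hmem p)
    rw [this]
    exact ENNReal.toReal_le_of_le_ofReal (by positivity) (hbd p p.2)
  have hJ : ∀ p : V, J p =ᵐ[ν] (p : PairSpace N m).fst := hJ₀
  refine ⟨J, fun p => hvν.ae_le (hJ p), ?_, ?_⟩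
  · rw [injective_iff_map_eq_zero]
    intro p hp
    have h1 := hJ p
    rw [hp] at h1
    have h2 : (p : PairSpace N m).fst = 0 := by
      refine Lp.ext ?_
      refine hmv.ae_le (hvν.ae_le ?_)
      filter_upwards [h1, Lp.coeFn_zero ℂ (ENNReal.ofReal q) ν,
        hνm.ae_le (Lp.coeFn_zero ℂ 2 m)] with x h3 h4 h5
      rw [← h3, h4, h5]
    exact Subtype.ext (hinj p p.2 h2)
  · refine (isCompactOperator_iff_isCompact_closure_image_ball (J : V →ₗ[ℂ] Lp ℂ (ENNReal.ofReal q) ν) one_pos).2 ?_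
    refine isCompact_iff_totallyBounded_isComplete.2
      ⟨TotallyBounded.closure ?_, isClosed_closure.isComplete⟩
    refine totallyBounded_of_forall_exists_isCompact fun ε hε => ?_
    obtain ⟨T, hT, HT⟩ := hcomp ε hε
    refine ⟨T, hT, ?_⟩
    rintro _ ⟨p, hp, rfl⟩
    have hp1 : ‖(p : PairSpace N m)‖ ≤ 1 := by
      simpa using (mem_ball_zero_iff.1 hp).le
    obtain ⟨t, ht, hpt⟩ := HT p p.2 hp1
    refine ⟨t, ht, ?_⟩
    rw [dist_eq_norm, Lp.norm_def]
    refine ENNReal.toReal_le_of_le_ofReal hε.le (le_trans (le_of_eq (eLpNorm_congr_ae ?_)) hpt)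
    filter_upwards [Lp.coeFn_sub (J p) t, hJ p] with x h1 h2
    rw [← h2]
    exact h1

theorem embedsCompactly_of_isTestLimit [Fact (1 ≤ ENNReal.ofReal q)] (hN : 3 ≤ N) (hq : 2 < q)
    (hq' : q < 2 * (N : ℝ) / ((N : ℝ) - 2)) (β : ℝ)
    {m ν : Measure (EuclideanSpace ℝ (Fin N))} (hm : m = powerMeasure N (2 * β - ((N : ℝ) - 2)))
    (hν : ν = powerMeasure N (β * q + -(((N : ℝ) - 2) / 2 * q)))
    {V : Submodule ℂ (PairSpace N m)} (hV : ∀ p ∈ V, IsTestLimit β p ∧ IsRadial m p.fst) :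
    EmbedsCompactly V q ν := by
  subst hm hν
  have hmv := volume_absolutelyContinuous_powerMeasure hN (2 * β - ((N : ℝ) - 2))
  obtain ⟨C, hC, HC⟩ := exists_eLpNorm_fst_le hN hq hq' β
  refine embedsCompactly_of_eLpNorm_le (powerMeasure_absolutelyContinuous_volume _)
    (volume_absolutelyContinuous_powerMeasure hN _)
    ((powerMeasure_absolutelyContinuous_volume _).trans hmv) hC
    (fun p hp => HC p (hV p hp).1 (hV p hp).2)
    (fun p hp => eq_zero_of_fst_eq_zero hN (hV p hp).1) fun ε hε => ?_
  obtain ⟨T, hT, HT⟩ := exists_isCompact_eLpNorm_sub_le hN hq hq' β hε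
  exact ⟨T, hT, fun p hp => HT p (hV p hp).1 (hV p hp).2⟩

end Embedding

/-! ### The two spaces as members of the family -/

theorem volume_eq_powerMeasure_zero (N : ℕ) :
    (volume : Measure (EuclideanSpace ℝ (Fin N))) = powerMeasure N 0 := by
  simp [powerMeasure]

theorem isTestLimit_of_mem_spaceCalH {N : ℕ} (hN : 3 ≤ N) {p : PairSpace N (hardyMeasure N)}
    (hp : p ∈ spaceCalH N) : IsTestLimit 0 p := by
  have hac := volume_absolutelyContinuous_powerMeasure hN (-((N : ℝ) - 2))
  obtain ⟨P, hP, hlim⟩ := mem_closure_iff_seq_limit.1 hp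
  choose φ hφ h1 h2 using hP
  refine ⟨P, φ, hlim, fun n => ⟨hφ n, ?_, h2 n⟩⟩
  filter_upwards [hac.ae_le (h1 n)] with x hx
  simp [hx, powMul]

theorem isTestLimit_of_mem_spaceH {N : ℕ} (hN : 3 ≤ N) {p : PairSpace N volume}
    (hp : p ∈ spaceH N hN) : IsTestLimit (((N : ℝ) - 2) / 2) p := by
  obtain ⟨P, hP, hlim⟩ := mem_closure_iff_seq_limit.1 hp
  choose φ hφ h1 h2 using hP
  refine ⟨P, φ, hlim, fun n => ⟨hφ n, h1 n, ?_⟩⟩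
  filter_upwards [h2 n, ae_ne_zero hN _] with x hx hx0
  rw [hx, cgrad_hardyTInv_hardyT _ hx0]

end HardyRadial

end

theorem mainTheorem7 (N : ℕ) (hN : 3 ≤ N) (q : ℝ) [Fact (1 ≤ ENNReal.ofReal q)]
    (hq : 2 < q) (hq' : q < 2 * (N : ℝ) / ((N : ℝ) - 2)) :
    HardyRadial.EmbedsCompactly (HardyRadial.radialPart (HardyRadial.spaceCalH N)) q
        (HardyRadial.powerMeasure N (-(((N : ℝ) - 2) / 2 * q))) ∧
      HardyRadial.EmbedsCompactly (HardyRadial.radialPart (HardyRadial.spaceH N hN)) q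
        (volume : Measure (EuclideanSpace ℝ (Fin N))) := by
  constructor
  · refine HardyRadial.embedsCompactly_of_isTestLimit hN hq hq' 0 ?_ ?_
      fun p hp => ⟨HardyRadial.isTestLimit_of_mem_spaceCalH hN hp.1, hp.2⟩
    · rw [HardyRadial.hardyMeasure]; congr 1; ring
    · congr 1; ring
  -- With `β = (N-2)/2` both exponents `2β - (N-2)` and `βq - (N-2)q/2` vanish, so both measures are
  -- Lebesgue measure.
  · refine HardyRadial.embedsCompactly_of_isTestLimit hN hq hq' (((N : ℝ) - 2) / 2) ?_ ?_
      fun p hp => ⟨HardyRadial.isTestLimit_of_mem_spaceH hN hp.1, hp.2⟩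
    · rw [HardyRadial.volume_eq_powerMeasure_zero]; congr 1; ring
    · rw [HardyRadial.volume_eq_powerMeasure_zero]; congr 1; ring
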